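/- **Corollary 5.5.** For a smooth map $x:U\to\mathbb R^3$ on an open set $U\subset\mathbb R^2$ with linearly independent $x_u,x_v$, let $E,F,G$ be the coefficients of the first fundamental form and $L,M,N$ those of the second with respect to the unit normal $l=\frac{x_u\times x_v}{|x_u\times x_v|}$. The map $x$ is a surface in *principal parameters* if $F=M=0$ on $U$; its invariants are then the principal curvatures $\nu_1=\frac LE$, $\nu_2=\frac NG$ and the geodesic curvatures of the principal lines, $\gamma_1=-\frac{E_v}{2E\sqrt G}$, $\gamma_2=\frac{G_u}{2G\sqrt E}$. It is *strongly regular* if $(\nu_1-\nu_2)\gamma_1\gamma_2\neq0$ everywhere on $U$. Let $\mathcal D\subset\mathbb R^2$ be open and let $\lambda:\mathcal D\to\mathbb R$ be a smooth solution of $$\lambda_{uu}+\lambda_{vv}=-\sinh\lambda$$ with $\lambda<0$ and $\lambda_u\lambda_v\ne0$ everywhere on $\mathcal D$. Then every point of $\mathcal D$ has a connected open neighbourhood $\mathcal D_0\subset\mathcal D$ on which there is a strongly regular surface $x:\mathcal D_0\to\mathbb R^3$ in principal parameters $(u,v)$ with Gaussian curvature $K=1$ and invariants $$\nu_1=-\coth\frac\lambda2,\qquad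 \nu_2=-\tanh\frac\lambda2,\qquad \gamma_1=-\frac{\lambda_v}{2\sinh\frac\lambda2},\qquad \gamma_2=-\frac{\lambda_u}{2\cosh\frac\lambda2}.$$ This surface is unique up to a motion: if $x$ and $y$ are two strongly regular surfaces in principal parameters with $K=1$ and these invariants on the same connected open set $U\subset\mathcal D$, then $y=Rx+t$ on $U$ for some rotation $R\in SO(3)$ and some $t\in\mathbb R^3$. -/

import Mathlib

open scoped ContDiff

noncomputable section

/-- Partial derivative with respect to the first parameter `u`. -/
def partialU {F : Type*} [NormedAddCommGroup F] [NormedSpace ℝ F]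
    (f : ℝ × ℝ → F) (p : ℝ × ℝ) : F :=
  fderiv ℝ f p (1, 0)

/-- Partial derivative with respect to the second parameter `v`. -/
def partialV {F : Type*} [NormedAddCommGroup F] [NormedSpace ℝ F]
    (f : ℝ × ℝ → F) (p : ℝ × ℝ) : F :=
  fderiv ℝ f p (0, 1)

/-- The Laplacian `Δ f = f_uu + f_vv` in the parameter plane. -/
def laplacianUV (f : ℝ × ℝ → ℝ) (p : ℝ × ℝ) : ℝ :=
  partialU (partialU f) p + partialV (partialV f) p

/-- Euclidean three-space. -/
abbrev E3 : Type := EuclideanSpace ℝ (Fin 3)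

/-- The vector product of Euclidean three-space with its standard orientation. -/
def cross3 (a b : E3) : E3 :=
  WithLp.toLp 2 (crossProduct (WithLp.ofLp a) (WithLp.ofLp b))

/-- First fundamental form, `E = ⟨x_u, x_u⟩`. -/
def coeffE (x : ℝ × ℝ → E3) (p : ℝ × ℝ) : ℝ := inner ℝ (partialU x p) (partialU x p)

/-- First fundamental form, `F = ⟨x_u, x_v⟩`. -/
def coeffF (x : ℝ × ℝ → E3) (p : ℝ × ℝ) : ℝ := inner ℝ (partialU x p) (partialV x p)

/-- First fundamental form, `G = ⟨x_v, x_v⟩`. -/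
def coeffG (x : ℝ × ℝ → E3) (p : ℝ × ℝ) : ℝ := inner ℝ (partialV x p) (partialV x p)

/-- The unit normal `l` for which the frame `x_u, x_v, l` is right oriented. -/
def unitNormal (x : ℝ × ℝ → E3) (p : ℝ × ℝ) : E3 :=
  ‖cross3 (partialU x p) (partialV x p)‖⁻¹ • cross3 (partialU x p) (partialV x p)

/-- Second fundamental form, `L = ⟨x_uu, l⟩`. -/
def coeffL (x : ℝ × ℝ → E3) (p : ℝ × ℝ) : ℝ :=
  inner ℝ (partialU (partialU x) p) (unitNormal x p)

/-- Second fundamental form, `M = ⟨x_uv, l⟩`. -/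
def coeffM (x : ℝ × ℝ → E3) (p : ℝ × ℝ) : ℝ :=
  inner ℝ (partialV (partialU x) p) (unitNormal x p)

/-- Second fundamental form, `N = ⟨x_vv, l⟩`. -/
def coeffN (x : ℝ × ℝ → E3) (p : ℝ × ℝ) : ℝ :=
  inner ℝ (partialV (partialV x) p) (unitNormal x p)

/-- Gaussian curvature `K = (LN - M²) / (EG - F²)`. -/
def gaussCurvature (x : ℝ × ℝ → E3) (p : ℝ × ℝ) : ℝ :=
  (coeffL x p * coeffN x p - coeffM x p ^ 2) / (coeffE x p * coeffG x p - coeffF x p ^ 2)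

/-- The principal curvature `ν₁ = L / E`, for a surface in principal parameters. -/
def nu1 (x : ℝ × ℝ → E3) (p : ℝ × ℝ) : ℝ := coeffL x p / coeffE x p

/-- The principal curvature `ν₂ = N / G`, for a surface in principal parameters. -/
def nu2 (x : ℝ × ℝ → E3) (p : ℝ × ℝ) : ℝ := coeffN x p / coeffG x p

/-- The geodesic curvature `γ₁ = -E_v / (2 E √G)` of the lines `v = const`, for a surface
in principal parameters. -/
def gamma1 (x : ℝ × ℝ → E3) (p : ℝ × ℝ) : ℝ :=
  -partialV (coeffE x) p / (2 * coeffE x p * √(coeffG x p))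

/-- The geodesic curvature `γ₂ = G_u / (2 G √E)` of the lines `u = const`, for a surface
in principal parameters. -/
def gamma2 (x : ℝ × ℝ → E3) (p : ℝ × ℝ) : ℝ :=
  partialU (coeffG x) p / (2 * coeffG x p * √(coeffE x p))

/-- On the open set `D`, the map `x` is a smooth regular surface in principal parameters:
an immersion with `F = M = 0`. -/
structure IsPrincipalSurface (x : ℝ × ℝ → E3) (D : Set (ℝ × ℝ)) : Prop where
  isOpen : IsOpen D
  smooth : ContDiffOn ℝ ∞ x D
  regular : ∀ p ∈ D, LinearIndependent ℝ ![partialU x p, partialV x p]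
  coeffF_eq_zero : ∀ p ∈ D, coeffF x p = 0
  coeffM_eq_zero : ∀ p ∈ D, coeffM x p = 0

/-- A strongly regular surface: `(ν₁ - ν₂) γ₁ γ₂ ≠ 0` everywhere. -/
structure IsStronglyRegular (x : ℝ × ℝ → E3) (D : Set (ℝ × ℝ)) : Prop
    extends IsPrincipalSurface x D where
  ne_zero : ∀ p ∈ D, (nu1 x p - nu2 x p) * gamma1 x p * gamma2 x p ≠ 0

/-- On `D`, the map `x` is a strongly regular surface of Gaussian curvature `1` whose invariants
are `ν₁ = -coth (λ/2)`, `ν₂ = -tanh (λ/2)`, `γ₁ = -λ_v / (2 sinh (λ/2))` and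
`γ₂ = -λ_u / (2 cosh (λ/2))`, where `λ` is the function `lam`. -/
structure IsSurfaceGeneratedBy (lam : ℝ × ℝ → ℝ) (x : ℝ × ℝ → E3) (D : Set (ℝ × ℝ)) : Prop where
  stronglyRegular : IsStronglyRegular x D
  gaussCurvature_eq_one : ∀ p ∈ D, gaussCurvature x p = 1
  nu1_eq : ∀ p ∈ D, nu1 x p = -(Real.cosh (lam p / 2) / Real.sinh (lam p / 2))
  nu2_eq : ∀ p ∈ D, nu2 x p = -Real.tanh (lam p / 2)
  gamma1_eq : ∀ p ∈ D, gamma1 x p = -(partialV lam p / (2 * Real.sinh (lam p / 2)))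
  gamma2_eq : ∀ p ∈ D, gamma2 x p = -(partialU lam p / (2 * Real.cosh (lam p / 2)))

/-- A motion of Euclidean three-space: a rotation (a linear isometry of determinant `1`)
followed by a translation. -/
def IsMotion (φ : E3 → E3) : Prop :=
  ∃ (R : E3 ≃ₗᵢ[ℝ] E3) (t : E3),
    LinearMap.det (R.toLinearEquiv : E3 →ₗ[ℝ] E3) = 1 ∧ ∀ z, φ z = R z + t

end

/-! Everything rests on the moving frame. Put `a = √E`, `b = √G`, `x_u = a X`, `x_v = b Y`, `l = X ×
Y`. For a surface in principal parameters the Gauss–Weingarten equations express the derivatives of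
`(X, Y, l, x)` linearly in the frame, with coefficients `a_v / b`, `b_u / a`, `a ν₁`, `b ν₂` and
`a`, `b` themselves. The choice `a = -sinh (λ/2)`, `b = cosh (λ/2)`, both positive because `λ < 0`,
turns these coefficients into `-λ_v/2`, `-λ_u/2`, `cosh (λ/2)` and `-sinh (λ/2)`; the result is the
system `IsSinhGordonFrame`.

Existence: the integrability condition of this linear system is the sinh-Gordon equation
(`conn_compatible`), so a Frobenius argument (`exists_hasFDerivAt_of_compatible`) produces a local
solution with any initial value. A solution that starts at an orthonormal frame stays orthonormal
because the frame part of the system is skew, and the fundamental forms can then be read off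
(`IsSinhGordonFrame.isSurfaceGeneratedBy`).

Uniqueness: the invariants do not mention `E` and `G`, but the Codazzi equations recover them.
Inserting the prescribed `γ₁`, `γ₂` and dividing by `λ_v`, `λ_u`, which do not vanish, leaves
exactly `b = cosh (λ/2)` and `a = -sinh (λ/2)` (`IsPrincipalFrame.eq_of_invariants`). Any two such
surfaces therefore have frames solving the same linear system, and on a connected set these differ
by one constant rotation; integrating gives the translation (`IsSinhGordonFrame.exists_isMotion`).
-/

open MeasureTheory Metric Set Filter Topology

/-! ### Local solvability of compatible linear total differential systems in the plane. -/

section Frobenius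

variable {H : Type*} [NormedAddCommGroup H] [NormedSpace ℝ H]

/-- On a small square, the Volterra equation obtained by integrating `A_u = P A` along the
horizontal axis and then `A_v = Q A` along vertical lines has a continuous solution. -/
theorem exists_continuous_eq_add_integral_add_integral [CompleteSpace H]
    {P Q : ℝ × ℝ → H →L[ℝ] H} (hP : Continuous P) (hQ : Continuous Q) (p₀ : ℝ × ℝ) (w₀ : H)
    {r M : ℝ} (hr : 0 ≤ r) (hPM : ∀ p ∈ closedBall p₀ r, ‖P p‖ ≤ M)
    (hQM : ∀ p ∈ closedBall p₀ r, ‖Q p‖ ≤ M) (hMr : 2 * M * r < 1) :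
    ∃ A : ℝ × ℝ → H, Continuous A ∧ ∀ p ∈ closedBall p₀ r,
      A p = w₀ + (∫ s in p₀.1..p.1, P (s, p₀.2) (A (s, p₀.2))) +
        ∫ t in p₀.2..p.2, Q (p.1, t) (A (p.1, t)) := by
  have hM : 0 ≤ M := (norm_nonneg _).trans (hPM p₀ (mem_closedBall_self hr))
  let I := Icc (p₀.1 - r) (p₀.1 + r)
  let J := Icc (p₀.2 - r) (p₀.2 + r)
  have hI : p₀.1 - r ≤ p₀.1 + r := by linarith
  have hJ : p₀.2 - r ≤ p₀.2 + r := by linarith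
  have hball : ∀ u v, u ∈ I → v ∈ J → (u, v) ∈ closedBall p₀ r := by
    intro u v hu hv
    rw [← closedBall_prod_same, Real.closedBall_eq_Icc, Real.closedBall_eq_Icc]
    exact ⟨hu, hv⟩
  have hu₀ : p₀.1 ∈ I := ⟨by linarith, by linarith⟩
  have hv₀ : p₀.2 ∈ J := ⟨by linarith, by linarith⟩
  -- Clamping both coordinates to the square extends each function continuously to the plane, so
  -- that the integrals make sense without membership proofs.
  let ext : C(I × J, H) → ℝ × ℝ → H := fun A p => A (projIcc _ _ hI p.1, projIcc _ _ hJ p.2)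
  have hext : ∀ A, Continuous (ext A) := fun A =>
    A.continuous.comp ((continuous_projIcc.comp continuous_fst).prodMk
      (continuous_projIcc.comp continuous_snd))
  let op : C(I × J, H) → ℝ × ℝ → H := fun A p =>
    w₀ + (∫ s in p₀.1..p.1, P (s, p₀.2) (ext A (s, p₀.2))) +
      ∫ t in p₀.2..p.2, Q (p.1, t) (ext A (p.1, t))
  have hcP : ∀ A, Continuous fun s => P (s, p₀.2) (ext A (s, p₀.2)) := fun A =>
    (hP.comp (by fun_prop)).clm_apply ((hext A).comp (by fun_prop))
  have hcQ : ∀ A, Continuous fun q : (ℝ × ℝ) × ℝ => Q (q.1.1, q.2) (ext A (q.1.1, q.2)) :=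
    fun A => (hQ.comp (by fun_prop)).clm_apply ((hext A).comp (by fun_prop))
  have hop : ∀ A, Continuous (op A) := by
    intro A
    refine (continuous_const.add ?_).add ?_
    · exact (intervalIntegral.continuous_primitive
        (fun a b => (hcP A).intervalIntegrable a b) _).comp continuous_fst
    · exact intervalIntegral.continuous_parametric_intervalIntegral_of_continuous
        (f := fun (p : ℝ × ℝ) t => Q (p.1, t) (ext A (p.1, t))) (hcQ A) continuous_snd
  let T : C(I × J, H) → C(I × J, H) := fun A =>
    ⟨fun q => op A (q.1, q.2), (hop A).comp (by fun_prop)⟩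
  have hdist : ∀ A B p, ‖ext A p - ext B p‖ ≤ dist A B := fun A B p => by
    rw [← dist_eq_norm]; exact ContinuousMap.dist_apply_le_dist _
  -- Each of the two integrals runs over a segment of length at most `r` and so contributes `M * r`
  -- to the Lipschitz constant in the sup norm.
  obtain ⟨κ, hκ⟩ : ∃ κ : NNReal, (κ : ℝ) = 2 * M * r :=
    ⟨⟨2 * M * r, by positivity⟩, rfl⟩
  have hT : ContractingWith κ T := by
    refine ⟨by rw [← NNReal.coe_lt_coe, hκ]; exact hMr, LipschitzWith.of_dist_le_mul fun A B => ?_⟩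
    rw [hκ, ContinuousMap.dist_le (by positivity)]
    rintro ⟨⟨u, hu⟩, ⟨v, hv⟩⟩
    have h1 : ‖∫ s in p₀.1..u, (P (s, p₀.2) (ext A (s, p₀.2)) - P (s, p₀.2) (ext B (s, p₀.2)))‖
        ≤ M * dist A B * |u - p₀.1| := by
      refine intervalIntegral.norm_integral_le_of_norm_le_const fun s hs => ?_
      rw [← map_sub]
      refine ((P _).le_opNorm _).trans (mul_le_mul (hPM _ ?_) (hdist _ _ _) (norm_nonneg _) hM)
      exact hball _ _ (ordConnected_Icc.uIcc_subset hu₀ hu (uIoc_subset_uIcc hs)) hv₀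
    have h2 : ‖∫ t in p₀.2..v, (Q (u, t) (ext A (u, t)) - Q (u, t) (ext B (u, t)))‖
        ≤ M * dist A B * |v - p₀.2| := by
      refine intervalIntegral.norm_integral_le_of_norm_le_const fun s hs => ?_
      rw [← map_sub]
      refine ((Q _).le_opNorm _).trans (mul_le_mul (hQM _ ?_) (hdist _ _ _) (norm_nonneg _) hM)
      exact hball _ _ hu (ordConnected_Icc.uIcc_subset hv₀ hv (uIoc_subset_uIcc hs))
    have hcQ' : ∀ A, Continuous fun t => Q (u, t) (ext A (u, t)) := fun A =>
      (hcQ A).comp (g := fun q : (ℝ × ℝ) × ℝ => Q (q.1.1, q.2) (ext A (q.1.1, q.2)))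
        (f := fun t => ((u, 0), t)) (by fun_prop)
    rw [intervalIntegral.integral_sub ((hcP A).intervalIntegrable _ _)
      ((hcP B).intervalIntegrable _ _)] at h1
    rw [intervalIntegral.integral_sub ((hcQ' A).intervalIntegrable _ _)
      ((hcQ' B).intervalIntegrable _ _)] at h2
    have hu' : |u - p₀.1| ≤ r := by rw [abs_le]; constructor <;> linarith [hu.1, hu.2]
    have hv' : |v - p₀.2| ≤ r := by rw [abs_le]; constructor <;> linarith [hv.1, hv.2]
    have hMd : 0 ≤ M * dist A B := by positivity
    change dist (op A (u, v)) (op B (u, v)) ≤ 2 * M * r * dist A B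
    rw [dist_eq_norm]
    have : op A (u, v) - op B (u, v) =
        ((∫ s in p₀.1..u, P (s, p₀.2) (ext A (s, p₀.2))) -
          ∫ s in p₀.1..u, P (s, p₀.2) (ext B (s, p₀.2))) +
        ((∫ t in p₀.2..v, Q (u, t) (ext A (u, t))) - ∫ t in p₀.2..v, Q (u, t) (ext B (u, t))) := by
      simp only [op]; abel
    rw [this]
    refine (norm_add_le _ _).trans ?_
    nlinarith [mul_le_mul_of_nonneg_left hu' hMd, mul_le_mul_of_nonneg_left hv' hMd]
  have : Nonempty C(I × J, H) := ⟨0⟩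
  obtain ⟨A, hA⟩ : ∃ A, T A = A := ⟨_, hT.fixedPoint_isFixedPt⟩
  refine ⟨ext A, hext A, fun p hp => ?_⟩
  rw [← closedBall_prod_same, Real.closedBall_eq_Icc, Real.closedBall_eq_Icc] at hp
  have h1 := DFunLike.congr_fun hA (⟨p.1, hp.1⟩, ⟨p.2, hp.2⟩)
  have h2 : ext A p = A (⟨p.1, hp.1⟩, ⟨p.2, hp.2⟩) := by
    simp only [ext]
    rw [projIcc_of_mem _ hp.1, projIcc_of_mem _ hp.2]
  rw [h2, ← h1]
  rfl

theorem hasDerivAt_prodMk_left {F : Type*} [NormedAddCommGroup F] [NormedSpace ℝ F]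
    {f : ℝ × ℝ → F} {u v : ℝ} (hf : DifferentiableAt ℝ f (u, v)) :
    HasDerivAt (fun s => f (s, v)) (partialU f (u, v)) u :=
  hf.hasFDerivAt.comp_hasDerivAt u ((hasDerivAt_id u).prodMk (hasDerivAt_const u v))

theorem hasDerivAt_prodMk_right {F : Type*} [NormedAddCommGroup F] [NormedSpace ℝ F]
    {f : ℝ × ℝ → F} {u v : ℝ} (hf : DifferentiableAt ℝ f (u, v)) :
    HasDerivAt (fun t => f (u, t)) (partialV f (u, v)) v :=
  hf.hasFDerivAt.comp_hasDerivAt v ((hasDerivAt_const v u).prodMk (hasDerivAt_id v))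

theorem exists_norm_le_closedBall {F : Type*} [NormedAddCommGroup F] {f : ℝ × ℝ → F}
    (hf : Continuous f) (p : ℝ × ℝ) (r : ℝ) : ∃ M, ∀ q ∈ closedBall p r, ‖f q‖ ≤ M :=
  (isCompact_closedBall p r).exists_bound_of_continuousOn hf.continuousOn

/-- Local solvability of the linear system `A_u = P A`, `A_v = Q A` under the compatibility
condition `Q_u + Q P = P_v + P Q`. -/
theorem exists_hasFDerivAt_of_compatible [CompleteSpace H]
    {P Q : ℝ × ℝ → H →L[ℝ] H} (hP : ContDiff ℝ 1 P) (hQ : ContDiff ℝ 1 Q) (p₀ : ℝ × ℝ) (w₀ : H)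
    (hflat : ∀ᶠ p in 𝓝 p₀, ∀ w, partialU Q p w + Q p (P p w) = partialV P p w + P p (Q p w)) :
    ∃ A : ℝ × ℝ → H, A p₀ = w₀ ∧ ∀ᶠ p in 𝓝 p₀, HasFDerivAt A
      (((1 : ℝ →L[ℝ] ℝ).smulRight (P p (A p))).coprod
        ((1 : ℝ →L[ℝ] ℝ).smulRight (Q p (A p)))) p := by
  have hQu : Continuous (partialU Q) :=
    (hQ.continuous_fderiv one_ne_zero).clm_apply continuous_const
  have hPv : Continuous (partialV P) :=
    (hP.continuous_fderiv one_ne_zero).clm_apply continuous_const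
  obtain ⟨M₁, hM₁⟩ := exists_norm_le_closedBall hP.continuous p₀ 1
  obtain ⟨M₂, hM₂⟩ := exists_norm_le_closedBall hQ.continuous p₀ 1
  obtain ⟨M₃, hM₃⟩ := exists_norm_le_closedBall hQu p₀ 1
  obtain ⟨M, hM0, hMM₁, hMM₂, hMM₃⟩ : ∃ M, 0 < M ∧ M₁ ≤ M ∧ M₂ ≤ M ∧ M₃ ≤ M :=
    ⟨max 1 (max M₁ (max M₂ M₃)), by simp⟩
  obtain ⟨δ, hδ, hflat⟩ := Metric.eventually_nhds_iff_ball.1 hflat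
  -- The Volterra equation is solved on radius `2 * r` and used on radius `r`, which leaves room for
  -- derivatives at boundary points. The three conditions keep the larger ball inside the unit ball,
  -- where `M` is a bound, and inside the region of compatibility, and make the map a contraction
  -- there.
  obtain ⟨r, hr, hr1, hrδ, hrM⟩ : ∃ r, 0 < r ∧ 2 * r ≤ 1 ∧ 2 * r < δ ∧ 4 * (M * r) < 1 := by
    refine ⟨min (1 / 2) (min (δ / 4) (1 / (8 * M))), by positivity, ?_, ?_, ?_⟩
    · linarith [min_le_left (1 / 2 : ℝ) (min (δ / 4) (1 / (8 * M)))]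
    · linarith [(min_le_right (1 / 2 : ℝ) (min (δ / 4) (1 / (8 * M)))).trans (min_le_left _ _)]
    · have h := mul_le_mul_of_nonneg_left
        ((min_le_right (1 / 2 : ℝ) (min (δ / 4) (1 / (8 * M)))).trans (min_le_right _ _)) hM0.le
      have h' : M * (1 / (8 * M)) = 1 / 8 := by field_simp
      linarith
  have hsub : closedBall p₀ (2 * r) ⊆ closedBall p₀ 1 := closedBall_subset_closedBall hr1
  obtain ⟨A, hAc, hA⟩ := exists_continuous_eq_add_integral_add_integral hP.continuous
    hQ.continuous p₀ w₀ (r := 2 * r) (M := M) (by positivity)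
    (fun p hp => (hM₁ p (hsub hp)).trans hMM₁) (fun p hp => (hM₂ p (hsub hp)).trans hMM₂)
    (by linarith)
  have hmem : ∀ {R u v}, (u, v) ∈ closedBall p₀ R ↔ |u - p₀.1| ≤ R ∧ |v - p₀.2| ≤ R := by
    intro R u v
    rw [← closedBall_prod_same]; simp [Real.dist_eq]
  have huIcc : ∀ {R a b s : ℝ}, |b - a| ≤ R → s ∈ uIcc a b → |s - a| ≤ R := fun h hs =>
    (abs_sub_left_of_mem_uIcc hs).trans h
  have hPA : Continuous fun p => P p (A p) := hP.continuous.clm_apply hAc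
  have hQA : Continuous fun p => Q p (A p) := hQ.continuous.clm_apply hAc
  -- the `v`-derivative of `A`
  have hAv : ∀ u v, |u - p₀.1| ≤ 2 * r → |v - p₀.2| < 2 * r →
      HasDerivAt (fun t => A (u, t)) (Q (u, v) (A (u, v))) v := by
    intro u v hu hv
    have h1 : HasDerivAt (fun x => w₀ + (∫ s in p₀.1..u, P (s, p₀.2) (A (s, p₀.2))) +
        ∫ t in p₀.2..x, Q (u, t) (A (u, t))) (Q (u, v) (A (u, v))) v := by
      have hc : Continuous fun t => Q (u, t) (A (u, t)) := hQA.comp (by fun_prop)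
      exact (hc.integral_hasStrictDerivAt p₀.2 v).hasDerivAt.const_add _
    refine h1.congr_of_eventuallyEq ?_
    have : ∀ᶠ t in 𝓝 v, |t - p₀.2| < 2 * r :=
      (by fun_prop : Continuous fun t : ℝ => |t - p₀.2|).continuousAt.eventually_lt_const hv
    filter_upwards [this] with t ht
    exact hA (u, t) (hmem.2 ⟨hu, ht.le⟩)
  -- the candidate whose `u`-derivative is `P A`
  let C : ℝ × ℝ → H := fun p => A (p₀.1, p.2) + ∫ s in p₀.1..p.1, P (s, p.2) (A (s, p.2))
  have hCu : ∀ u v, HasDerivAt (fun s => C (s, v)) (P (u, v) (A (u, v))) u := by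
    intro u v
    have hc : Continuous fun s => P (s, v) (A (s, v)) := hPA.comp (by fun_prop)
    exact (hc.integral_hasStrictDerivAt p₀.1 u).hasDerivAt.const_add (A (p₀.1, v))
  have hCc : Continuous C := by
    refine (hAc.comp (by fun_prop)).add ?_
    exact intervalIntegral.continuous_parametric_intervalIntegral_of_continuous
      (f := fun (p : ℝ × ℝ) s => P (s, p.2) (A (s, p.2)))
      (hPA.comp (by fun_prop : Continuous fun q : (ℝ × ℝ) × ℝ => (q.2, q.1.2))) continuous_fst
  let g : ℝ × ℝ → H := fun p => partialV P p (A p) + P p (Q p (A p))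
  have hg : Continuous g := (hPv.clm_apply hAc).add (hP.continuous.clm_apply hQA)
  have hCv : ∀ u v, |u - p₀.1| ≤ 2 * r → |v - p₀.2| < 2 * r →
      HasDerivAt (fun t => C (u, t))
        (Q (p₀.1, v) (A (p₀.1, v)) + ∫ s in p₀.1..u, g (s, v)) v := by
    intro u v hu hv
    refine (hAv p₀.1 v (by simp; positivity) hv).add ?_
    obtain ⟨K, hK⟩ := exists_norm_le_closedBall hg p₀ (2 * r)
    have hnhds : {t : ℝ | |t - p₀.2| < 2 * r} ∈ 𝓝 v :=
      (by fun_prop : Continuous fun t : ℝ => |t - p₀.2|).continuousAt.eventually_lt_const hv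
    have hc : ∀ t, Continuous fun s => P (s, t) (A (s, t)) := fun t => hPA.comp (by fun_prop)
    refine (intervalIntegral.hasDerivAt_integral_of_dominated_loc_of_deriv_le
      (F := fun t s => P (s, t) (A (s, t))) (F' := fun t s => g (s, t)) (bound := fun _ => K)
      hnhds (.of_forall fun t => (hc t).aestronglyMeasurable) ((hc v).intervalIntegrable _ _)
      (hg.comp (by fun_prop : Continuous fun s => (s, v))).aestronglyMeasurable
      (.of_forall fun s hs t ht => ?_) intervalIntegrable_const (.of_forall fun s hs t ht => ?_)).2
    · exact hK _ (hmem.2 ⟨huIcc hu (uIoc_subset_uIcc hs), le_of_lt ht⟩)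
    · exact (hasDerivAt_prodMk_right (hP.differentiable one_ne_zero _)).clm_apply
        (hAv s t (huIcc hu (uIoc_subset_uIcc hs)) ht)
  -- the difference of the two solves a homogeneous Volterra equation
  let Z : ℝ × ℝ → H := fun p => C p - A p
  have hZc : Continuous Z := hCc.sub hAc
  -- Compatibility rewrites `g` as `Q_u A + Q P A`. Since `C_u = P A`, the derivative `(Q C)_u` is
  -- `Q_u C + Q P A`, so the two differ by `Q_u Z` and the rest integrates exactly. Working with `C`
  -- avoids differentiating `A` in `u`, which is not yet justified.
  have hQC : ∀ u v, |u - p₀.1| ≤ 2 * r → |v - p₀.2| < 2 * r →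
      ∫ s in p₀.1..u, g (s, v) =
        Q (u, v) (C (u, v)) - Q (p₀.1, v) (A (p₀.1, v)) -
          ∫ s in p₀.1..u, partialU Q (s, v) (Z (s, v)) := by
    intro u v hu hv
    have hc1 : Continuous fun s => partialU Q (s, v) (C (s, v)) + Q (s, v) (P (s, v) (A (s, v))) :=
      ((hQu.clm_apply hCc).add (hQ.continuous.clm_apply hPA)).comp (by fun_prop)
    have hc2 : Continuous fun s => partialU Q (s, v) (Z (s, v)) :=
      (hQu.clm_apply hZc).comp (by fun_prop)
    have h1 := intervalIntegral.integral_eq_sub_of_hasDerivAt (a := p₀.1) (b := u)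
      (f := fun s => Q (s, v) (C (s, v)))
      (fun s _ => (hasDerivAt_prodMk_left (hQ.differentiable one_ne_zero _)).clm_apply (hCu s v))
      (hc1.intervalIntegrable _ _)
    have h2 : C (p₀.1, v) = A (p₀.1, v) := by simp [C]
    rw [h2] at h1
    rw [← h1, ← intervalIntegral.integral_sub (hc1.intervalIntegrable _ _)
      (hc2.intervalIntegrable _ _)]
    refine intervalIntegral.integral_congr fun s hs => ?_
    have h3 := hflat (s, v) (closedBall_subset_ball hrδ (hmem.2 ⟨huIcc hu hs, hv.le⟩)) (A (s, v))
    simp only [g, Z, map_sub]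
    rw [← h3]
    abel
  have hZv : ∀ u v, |u - p₀.1| ≤ 2 * r → |v - p₀.2| < 2 * r →
      HasDerivAt (fun t => Z (u, t))
        (Q (u, v) (Z (u, v)) - ∫ s in p₀.1..u, partialU Q (s, v) (Z (s, v))) v := by
    intro u v hu hv
    refine ((hCv u v hu hv).sub (hAv u v hu hv)).congr_deriv ?_
    rw [hQC u v hu hv]
    simp only [Z, map_sub]
    abel
  have hZ0 : ∀ u, |u - p₀.1| ≤ 2 * r → Z (u, p₀.2) = 0 := by
    intro u hu
    have h1 := hA (u, p₀.2) (hmem.2 ⟨hu, by simp; positivity⟩)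
    have h2 := hA (p₀.1, p₀.2) (hmem.2 ⟨by simp; positivity, by simp; positivity⟩)
    simp only [intervalIntegral.integral_same, add_zero] at h1 h2
    simp only [Z, C]
    rw [h1, h2, sub_self]
  -- At a maximum `q` of `‖Z‖` on the closed ball, the mean value inequality along the vertical
  -- segment from the axis, where `Z` vanishes, gives `‖Z q‖ ≤ 2 * M * r * ‖Z q‖`. The factor is
  -- below `1/2`, so the maximum is zero.
  have hZ : ∀ p ∈ closedBall p₀ r, Z p = 0 := by
    obtain ⟨q, hq, hmax⟩ := (isCompact_closedBall p₀ r).exists_isMaxOn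
      ⟨p₀, mem_closedBall_self hr.le⟩ hZc.norm.continuousOn
    have hmax : ∀ p ∈ closedBall p₀ r, ‖Z p‖ ≤ ‖Z q‖ := hmax
    have hq' := hmem.1 (show (q.1, q.2) ∈ closedBall p₀ r from hq)
    have hbound : ∀ v ∈ uIcc p₀.2 q.2,
        ‖Q (q.1, v) (Z (q.1, v)) - ∫ s in p₀.1..q.1, partialU Q (s, v) (Z (s, v))‖
          ≤ 2 * M * ‖Z q‖ := by
      intro v hv
      have hv' := huIcc hq'.2 hv
      have hb : ∀ s ∈ uIcc p₀.1 q.1, (s, v) ∈ closedBall p₀ r := fun s hs =>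
        hmem.2 ⟨huIcc hq'.1 hs, hv'⟩
      have hin : ∀ {x}, x ∈ closedBall p₀ r → x ∈ closedBall p₀ 1 := fun hx =>
        closedBall_subset_closedBall (by linarith) hx
      have h1 : ‖Q (q.1, v) (Z (q.1, v))‖ ≤ M * ‖Z q‖ := by
        have := hb _ right_mem_uIcc
        exact ((Q _).le_opNorm _).trans
          (mul_le_mul ((hM₂ _ (hin this)).trans hMM₂) (hmax _ this) (norm_nonneg _) hM0.le)
      have h2 : ‖∫ s in p₀.1..q.1, partialU Q (s, v) (Z (s, v))‖ ≤ M * ‖Z q‖ * |q.1 - p₀.1| := by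
        refine intervalIntegral.norm_integral_le_of_norm_le_const fun s hs => ?_
        have := hb _ (uIoc_subset_uIcc hs)
        exact ((partialU Q _).le_opNorm _).trans
          (mul_le_mul ((hM₃ _ (hin this)).trans hMM₃) (hmax _ this) (norm_nonneg _) hM0.le)
      have h3 : M * ‖Z q‖ * |q.1 - p₀.1| ≤ M * ‖Z q‖ * 1 :=
        mul_le_mul_of_nonneg_left (by linarith [hq'.1]) (by positivity)
      linarith [norm_sub_le (Q (q.1, v) (Z (q.1, v)))
        (∫ s in p₀.1..q.1, partialU Q (s, v) (Z (s, v)))]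
    have h1 := (convex_uIcc p₀.2 q.2).norm_image_sub_le_of_norm_hasDerivWithin_le
      (f := fun v => Z (q.1, v)) (fun v hv => (hZv q.1 v (by linarith [hq'.1])
        (by linarith [huIcc hq'.2 hv])).hasDerivWithinAt) hbound left_mem_uIcc right_mem_uIcc
    simp only [hZ0 q.1 (by linarith [hq'.1]), sub_zero, Real.norm_eq_abs] at h1
    have h2 : ‖Z q‖ = 0 := by
      have h3 : 2 * M * ‖Z q‖ * |q.2 - p₀.2| ≤ 2 * M * ‖Z q‖ * r :=
        mul_le_mul_of_nonneg_left hq'.2 (by positivity)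
      have h4 : ‖Z q‖ ≤ 2 * M * ‖Z q‖ * |q.2 - p₀.2| := h1
      nlinarith [norm_nonneg (Z q)]
    intro p hp
    simpa [h2] using hmax p hp
  refine ⟨A, ?_, ?_⟩
  · simpa using hA p₀ (mem_closedBall_self (by positivity))
  · filter_upwards [ball_mem_nhds p₀ hr] with p hp
    have hev := isOpen_ball.mem_nhds hp
    have hAu : ∀ q ∈ ball p₀ r, HasDerivAt (fun s => A (s, q.2)) (P q (A q)) q.1 := by
      intro q hq
      refine (hCu q.1 q.2).congr_of_eventuallyEq ?_
      have : ∀ᶠ s in 𝓝 q.1, (s, q.2) ∈ ball p₀ r :=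
        (by fun_prop : Continuous fun s : ℝ => (s, q.2)).continuousAt (isOpen_ball.mem_nhds hq)
      filter_upwards [this] with s hs
      exact (sub_eq_zero.1 (hZ _ (ball_subset_closedBall hs))).symm
    have hcl : ∀ f : ℝ × ℝ → H, Continuous f →
        Continuous fun p => (1 : ℝ →L[ℝ] ℝ).smulRight (f p) := fun f hf => by fun_prop
    -- Both partial derivatives exist near `p` and are continuous, which gives Fréchet
    -- differentiability.
    refine (hasStrictFDerivAt_uncurry_coprod (𝕜 := ℝ) (u := p) (f := fun u v => A (u, v))
      (f₁ := fun u v => (1 : ℝ →L[ℝ] ℝ).smulRight (P (u, v) (A (u, v))))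
      (f₂ := fun u v => (1 : ℝ →L[ℝ] ℝ).smulRight (Q (u, v) (A (u, v))))
      ?_ ?_ (hcl _ hPA).continuousAt (hcl _ hQA).continuousAt).hasFDerivAt
    · filter_upwards [hev] with q hq using (hAu q hq).hasFDerivAt
    · filter_upwards [hev] with q hq
      have := hmem.1 (show (q.1, q.2) ∈ closedBall p₀ r from ball_subset_closedBall hq)
      exact (hAv q.1 q.2 (by linarith) (by linarith)).hasFDerivAt

end Frobenius

/-! ### Rules for partial derivatives, regularity of solutions and smooth extension of germs. -/

section Calculus

variable {F : Type*} [NormedAddCommGroup F] [NormedSpace ℝ F] {f g : ℝ × ℝ → F}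
  {c d : ℝ × ℝ → ℝ} {p : ℝ × ℝ} {D : Set (ℝ × ℝ)}

theorem fderiv_eq_zero_of_partials (hu : partialU f p = 0) (hv : partialV f p = 0) :
    fderiv ℝ f p = 0 := by
  ext
  · simpa [partialU] using hu
  · simpa [partialV] using hv

theorem partialU_congr (h : f =ᶠ[𝓝 p] g) : partialU f p = partialU g p := by
  rw [partialU, h.fderiv_eq, partialU]

theorem partialV_congr (h : f =ᶠ[𝓝 p] g) : partialV f p = partialV g p := by
  rw [partialV, h.fderiv_eq, partialV]

theorem partialU_congr_of_isOpen (hD : IsOpen D) (h : EqOn f g D) (hp : p ∈ D) :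
    partialU f p = partialU g p :=
  partialU_congr (h.eventuallyEq_of_mem (hD.mem_nhds hp))

theorem partialV_congr_of_isOpen (hD : IsOpen D) (h : EqOn f g D) (hp : p ∈ D) :
    partialV f p = partialV g p :=
  partialV_congr (h.eventuallyEq_of_mem (hD.mem_nhds hp))

theorem partialU_const (a : F) : partialU (fun _ => a) p = 0 := by simp [partialU]

theorem partialV_const (a : F) : partialV (fun _ => a) p = 0 := by simp [partialV]

theorem partialU_add (hf : DifferentiableAt ℝ f p) (hg : DifferentiableAt ℝ g p) :
    partialU (fun q => f q + g q) p = partialU f p + partialU g p := by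
  simp [partialU, fderiv_fun_add hf hg]

theorem partialV_add (hf : DifferentiableAt ℝ f p) (hg : DifferentiableAt ℝ g p) :
    partialV (fun q => f q + g q) p = partialV f p + partialV g p := by
  simp [partialV, fderiv_fun_add hf hg]

theorem partialU_smul (hc : DifferentiableAt ℝ c p) (hf : DifferentiableAt ℝ f p) :
    partialU (fun q => c q • f q) p = c p • partialU f p + partialU c p • f p := by
  simp [partialU, fderiv_fun_smul hc hf]

theorem partialV_smul (hc : DifferentiableAt ℝ c p) (hf : DifferentiableAt ℝ f p) :
    partialV (fun q => c q • f q) p = c p • partialV f p + partialV c p • f p := by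
  simp [partialV, fderiv_fun_smul hc hf]

theorem partialU_mul (hc : DifferentiableAt ℝ c p) (hd : DifferentiableAt ℝ d p) :
    partialU (fun q => c q * d q) p = c p * partialU d p + partialU c p * d p :=
  partialU_smul hc hd

theorem partialV_mul (hc : DifferentiableAt ℝ c p) (hd : DifferentiableAt ℝ d p) :
    partialV (fun q => c q * d q) p = c p * partialV d p + partialV c p * d p :=
  partialV_smul hc hd

theorem partialU_clm {G : Type*} [NormedAddCommGroup G] [NormedSpace ℝ G] (T : F →L[ℝ] G)
    (hf : DifferentiableAt ℝ f p) : partialU (fun q => T (f q)) p = T (partialU f p) := by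
  have := (T.hasFDerivAt.comp p hf.hasFDerivAt).fderiv
  simp only [partialU]
  exact congrArg (· (1, 0)) this

theorem partialV_clm {G : Type*} [NormedAddCommGroup G] [NormedSpace ℝ G] (T : F →L[ℝ] G)
    (hf : DifferentiableAt ℝ f p) : partialV (fun q => T (f q)) p = T (partialV f p) := by
  have := (T.hasFDerivAt.comp p hf.hasFDerivAt).fderiv
  simp only [partialV]
  exact congrArg (· (0, 1)) this

theorem partialU_comp {h : ℝ → ℝ} {h' : ℝ} (hh : HasDerivAt h h' (c p))
    (hc : DifferentiableAt ℝ c p) : partialU (fun q => h (c q)) p = h' * partialU c p := by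
  have := (hh.comp_hasFDerivAt p hc.hasFDerivAt).fderiv
  simp only [partialU]
  exact congrArg (· (1, 0)) this

theorem partialV_comp {h : ℝ → ℝ} {h' : ℝ} (hh : HasDerivAt h h' (c p))
    (hc : DifferentiableAt ℝ c p) : partialV (fun q => h (c q)) p = h' * partialV c p := by
  have := (hh.comp_hasFDerivAt p hc.hasFDerivAt).fderiv
  simp only [partialV]
  exact congrArg (· (0, 1)) this

theorem partialU_inner {x y : ℝ × ℝ → E3} (hx : DifferentiableAt ℝ x p)
    (hy : DifferentiableAt ℝ y p) : partialU (fun q => inner ℝ (x q) (y q)) p =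
      inner ℝ (x p) (partialU y p) + inner ℝ (partialU x p) (y p) :=
  fderiv_inner_apply ℝ hx hy _

theorem partialV_inner {x y : ℝ × ℝ → E3} (hx : DifferentiableAt ℝ x p)
    (hy : DifferentiableAt ℝ y p) : partialV (fun q => inner ℝ (x q) (y q)) p =
      inner ℝ (x p) (partialV y p) + inner ℝ (partialV x p) (y p) :=
  fderiv_inner_apply ℝ hx hy _

theorem ContDiffOn.differentiableAt_of_isOpen (hf : ContDiffOn ℝ ∞ f D) (hD : IsOpen D)
    (hp : p ∈ D) : DifferentiableAt ℝ f p :=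
  (hf.contDiffAt (hD.mem_nhds hp)).differentiableAt (by simp)

theorem ContDiffOn.partialU (hf : ContDiffOn ℝ ∞ f D) (hD : IsOpen D) :
    ContDiffOn ℝ ∞ (partialU f) D :=
  (hf.fderiv_of_isOpen hD le_rfl).clm_apply contDiffOn_const

theorem ContDiffOn.partialV (hf : ContDiffOn ℝ ∞ f D) (hD : IsOpen D) :
    ContDiffOn ℝ ∞ (partialV f) D :=
  (hf.fderiv_of_isOpen hD le_rfl).clm_apply contDiffOn_const

theorem partialV_partialU_comm (hf : ContDiffOn ℝ ∞ f D) (hD : IsOpen D) (hp : p ∈ D) :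
    partialV (partialU f) p = partialU (partialV f) p := by
  have hfp := hf.contDiffAt (hD.mem_nhds hp)
  have hd : DifferentiableAt ℝ (fderiv ℝ f) p :=
    (hf.fderiv_of_isOpen hD (m := ∞) le_rfl).differentiableAt_of_isOpen hD hp
  have h1 : partialV (partialU f) p = fderiv ℝ (fderiv ℝ f) p (0, 1) (1, 0) :=
    partialV_clm (ContinuousLinearMap.apply ℝ F (1, 0)) hd
  have h2 : partialU (partialV f) p = fderiv ℝ (fderiv ℝ f) p (1, 0) (0, 1) :=
    partialU_clm (ContinuousLinearMap.apply ℝ F (0, 1)) hd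
  rw [h1, h2]
  refine (hfp.isSymmSndFDerivAt ?_).eq _ _
  rw [minSmoothness_of_isRCLikeNormedField]
  exact WithTop.coe_le_coe.2 (le_top : (2 : ℕ∞) ≤ ⊤)

/-- A solution of a linear first-order system with smooth coefficients is smooth. -/
theorem contDiffOn_of_hasFDerivAt_linear {P Q : ℝ × ℝ → F →L[ℝ] F} (hP : ContDiffOn ℝ ∞ P D)
    (hQ : ContDiffOn ℝ ∞ Q D) (hD : IsOpen D) (hf : ∀ p ∈ D, HasFDerivAt f
      (((1 : ℝ →L[ℝ] ℝ).smulRight (P p (f p))).coprod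
        ((1 : ℝ →L[ℝ] ℝ).smulRight (Q p (f p)))) p) : ContDiffOn ℝ ∞ f D := by
  refine contDiffOn_infty.2 fun n => ?_
  -- Bootstrapping: if `f` is of class `C^n`, the right-hand side of the system is too, and it is
  -- the derivative of `f`.
  induction n with
  | zero =>
    exact contDiffOn_zero.2 fun p hp => (hf p hp).continuousAt.continuousWithinAt
  | succ n ih =>
    refine (contDiffOn_succ_iff_fderiv_of_isOpen hD).2
      ⟨fun p hp => (hf p hp).differentiableAt.differentiableWithinAt,
        fun h => absurd h (WithTop.natCast_ne_top n), ?_⟩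
    have hle : ((n : ℕ) : WithTop ℕ∞) ≤ (∞ : WithTop ℕ∞) := by exact_mod_cast le_top
    have h1 : ContDiffOn ℝ n (fun p => P p (f p)) D := (hP.of_le hle).clm_apply ih
    have h2 : ContDiffOn ℝ n (fun p => Q p (f p)) D := (hQ.of_le hle).clm_apply ih
    have h3 : ContDiffOn ℝ n (fun p =>
        (ContinuousLinearMap.fst ℝ ℝ ℝ).smulRight (P p (f p)) +
          (ContinuousLinearMap.snd ℝ ℝ ℝ).smulRight (Q p (f p))) D :=
      (contDiffOn_const.smulRight h1).add (contDiffOn_const.smulRight h2)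
    refine h3.congr fun p hp => ?_
    rw [(hf p hp).fderiv]
    ext <;> simp

/-- A function which is smooth on an open set agrees near any point of it with a globally smooth
function. -/
theorem exists_contDiff_eventuallyEq (hf : ContDiffOn ℝ ∞ f D) (hD : IsOpen D) (hp : p ∈ D) :
    ∃ g : ℝ × ℝ → F, ContDiff ℝ ∞ g ∧ g =ᶠ[𝓝 p] f := by
  obtain ⟨r, hr, hrD⟩ := Metric.nhds_basis_closedBall.mem_iff.1 (hD.mem_nhds hp)
  -- A cutoff equal to `1` near `p` and supported in a closed ball inside `D`: the product with `f`
  -- keeps the germ at `p` and vanishes near every point outside `D`.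
  let χ : ContDiffBump p := ⟨r / 2, r, by positivity, by linarith⟩
  refine ⟨fun q => χ q • f q, ?_, ?_⟩
  · refine contDiff_iff_contDiffAt.2 fun q => ?_
    by_cases hq : q ∈ D
    · exact χ.contDiff.contDiffAt.smul (hf.contDiffAt (hD.mem_nhds hq))
    · have hq' : q ∉ tsupport χ := fun h => hq (hrD (by rwa [χ.tsupport_eq] at h))
      refine contDiffAt_const (c := (0 : F)) |>.congr_of_eventuallyEq ?_
      filter_upwards [notMem_tsupport_iff_eventuallyEq.1 hq'] with y hy
      simp [hy]
  · filter_upwards [χ.eventuallyEq_one] with q hq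
    simp [hq]

end Calculus

/-! ### Right-handed orthonormal frames, the vector product and rotations. -/

noncomputable section Orthonormal

variable {X Y Z X' Y' Z' : E3}

theorem inner_eq_sum_three (a b : E3) : inner ℝ a b = a 0 * b 0 + a 1 * b 1 + a 2 * b 2 := by
  simp [PiLp.inner_apply, Fin.sum_univ_three, mul_comm]

theorem cross3_apply_zero (a b : E3) : cross3 a b 0 = a 1 * b 2 - a 2 * b 1 := by
  simp [cross3, cross_apply]

theorem cross3_apply_one (a b : E3) : cross3 a b 1 = a 2 * b 0 - a 0 * b 2 := by
  simp [cross3, cross_apply]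

theorem cross3_apply_two (a b : E3) : cross3 a b 2 = a 0 * b 1 - a 1 * b 0 := by
  simp [cross3, cross_apply]

theorem inner_cross3_left (a b : E3) : inner ℝ a (cross3 a b) = 0 := by
  rw [inner_eq_sum_three, cross3_apply_zero, cross3_apply_one, cross3_apply_two]; ring

theorem inner_cross3_right (a b : E3) : inner ℝ b (cross3 a b) = 0 := by
  rw [inner_eq_sum_three, cross3_apply_zero, cross3_apply_one, cross3_apply_two]; ring

theorem inner_cross3_self (a b : E3) : inner ℝ (cross3 a b) (cross3 a b) =
    (inner ℝ a a * inner ℝ b b - inner ℝ a b ^ 2 : ℝ) := by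
  simp only [inner_eq_sum_three, cross3_apply_zero, cross3_apply_one, cross3_apply_two]; ring

theorem cross3_smul_smul (s t : ℝ) (a b : E3) :
    cross3 (s • a) (t • b) = (s * t) • cross3 a b := by
  simp [cross3, smul_smul, mul_comm]

theorem ContDiffOn.cross3 {x y : ℝ × ℝ → E3} {D : Set (ℝ × ℝ)} (hx : ContDiffOn ℝ ∞ x D)
    (hy : ContDiffOn ℝ ∞ y D) : ContDiffOn ℝ ∞ (fun p => cross3 (x p) (y p)) D := by
  have hx' := contDiffOn_euclidean.1 hx
  have hy' := contDiffOn_euclidean.1 hy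
  refine contDiffOn_euclidean.2 fun i => ?_
  fin_cases i
  · simpa only [Fin.zero_eta, cross3_apply_zero] using
      ((hx' 1).mul (hy' 2)).sub ((hx' 2).mul (hy' 1))
  · simpa only [Fin.mk_one, cross3_apply_one] using
      ((hx' 2).mul (hy' 0)).sub ((hx' 0).mul (hy' 2))
  · simpa only [Fin.reduceFinMk, cross3_apply_two] using
      ((hx' 0).mul (hy' 1)).sub ((hx' 1).mul (hy' 0))

theorem orthonormal_three_iff : Orthonormal ℝ ![X, Y, Z] ↔
    inner ℝ X X = (1 : ℝ) ∧ inner ℝ Y Y = (1 : ℝ) ∧ inner ℝ Z Z = (1 : ℝ) ∧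
      inner ℝ X Y = (0 : ℝ) ∧ inner ℝ X Z = (0 : ℝ) ∧ inner ℝ Y Z = (0 : ℝ) := by
  rw [orthonormal_iff_ite]
  constructor
  · intro h
    exact ⟨by simpa using h 0 0, by simpa using h 1 1, by simpa using h 2 2,
      by simpa using h 0 1, by simpa using h 0 2, by simpa using h 1 2⟩
  · rintro ⟨h1, h2, h3, h4, h5, h6⟩ i j
    fin_cases i <;> fin_cases j
    exacts [h1, h4, h5, (real_inner_comm X Y).trans h4, h2, h6, (real_inner_comm X Z).trans h5,
      (real_inner_comm Y Z).trans h6, h3]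

/-- An orthonormal triple as an orthonormal basis of three-space. -/
def frameBasis (h : Orthonormal ℝ ![X, Y, Z]) : OrthonormalBasis (Fin 3) ℝ E3 :=
  OrthonormalBasis.mk h (by
    rw [LinearIndependent.span_eq_top_of_card_eq_finrank' h.linearIndependent (by simp)])

theorem Orthonormal.eq_sum_three (h : Orthonormal ℝ ![X, Y, Z]) (w : E3) :
    w = (inner ℝ X w : ℝ) • X + (inner ℝ Y w : ℝ) • Y + (inner ℝ Z w : ℝ) • Z := by
  have := (frameBasis h).sum_repr' w
  simpa [frameBasis, Fin.sum_univ_three] using this.symm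

/-- The vector product is orthogonal to `X` and `Y`, hence equals `c • Z`; Lagrange's identity gives
`c ^ 2 = 1` and the sign hypothesis selects `c = 1`. A mere sign condition is what continuity can
supply in the existence proof. -/
theorem Orthonormal.cross3_eq (h : Orthonormal ℝ ![X, Y, Z])
    (hpos : 0 < (inner ℝ Z (cross3 X Y) : ℝ)) : cross3 X Y = Z := by
  have h1 := h.eq_sum_three (cross3 X Y)
  obtain ⟨hX, hY, hZ, hXY, -, -⟩ := orthonormal_three_iff.1 h
  have h2 := inner_cross3_self X Y
  rw [inner_cross3_left, inner_cross3_right, zero_smul, zero_smul, zero_add, zero_add] at h1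
  rw [hX, hY, hXY] at h2
  set c : ℝ := inner ℝ Z (cross3 X Y)
  rw [h1, real_inner_smul_left, real_inner_smul_right, hZ] at h2
  have hc : c = 1 := by nlinarith
  rw [h1, hc, one_smul]

theorem orthonormal_cross3 (hX : inner ℝ X X = (1 : ℝ)) (hY : inner ℝ Y Y = (1 : ℝ))
    (hXY : inner ℝ X Y = (0 : ℝ)) : Orthonormal ℝ ![X, Y, cross3 X Y] :=
  orthonormal_three_iff.2 ⟨hX, hY, by rw [inner_cross3_self, hX, hY, hXY]; norm_num, hXY,
    inner_cross3_left _ _, inner_cross3_right _ _⟩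

/-- Three vectors satisfying Parseval's identity are orthonormal. -/
theorem orthonormal_three_of_inner_mul_inner
    (h : ∀ z w : E3, (inner ℝ X z * inner ℝ X w + inner ℝ Y z * inner ℝ Y w +
      inner ℝ Z z * inner ℝ Z w : ℝ) = inner ℝ z w) : Orthonormal ℝ ![X, Y, Z] := by
  let A : Matrix (Fin 3) (Fin 3) ℝ := Matrix.of fun i j => ![X, Y, Z] i j
  -- With the three vectors as rows of `A`, Parseval's identity on basis vectors is `Aᵀ A = 1`. For
  -- a square matrix this gives `A Aᵀ = 1`, which is orthonormality of the rows.
  have hA : A.transpose * A = 1 := by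
    ext i j
    have := h (EuclideanSpace.single i 1) (EuclideanSpace.single j 1)
    simp only [EuclideanSpace.inner_single_right, one_mul] at this
    simpa [A, Matrix.mul_apply, Fin.sum_univ_three, Matrix.one_apply, Pi.single_apply,
      eq_comm] using this
  have hA' := mul_eq_one_comm.1 hA
  rw [orthonormal_iff_ite]
  intro i j
  have := congrFun (congrFun hA' i) j
  rw [Matrix.one_apply] at this
  rw [← this, inner_eq_sum_three]
  simp [A, Matrix.mul_apply, Fin.sum_univ_three]

theorem cross3_basis : cross3 (EuclideanSpace.single 0 1) (EuclideanSpace.single 1 1) =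
    EuclideanSpace.single 2 1 := by
  ext i
  fin_cases i <;> simp [cross3, cross_apply]

/-- The rotation carrying one right-handed orthonormal frame to another one. -/
theorem exists_rotation (h : Orthonormal ℝ ![X, Y, Z]) (h' : Orthonormal ℝ ![X', Y', Z'])
    (hc : cross3 X Y = Z) (hc' : cross3 X' Y' = Z') :
    ∃ R : E3 ≃ₗᵢ[ℝ] E3, LinearMap.det (R.toLinearEquiv : E3 →ₗ[ℝ] E3) = 1 ∧
      ∀ z, R z = (inner ℝ X z : ℝ) • X' + (inner ℝ Y z : ℝ) • Y' + (inner ℝ Z z : ℝ) • Z' := by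
  let R := (frameBasis h).equiv (frameBasis h') (Equiv.refl _)
  have hX : R X = X' := by
    have := (frameBasis h).equiv_apply_basis (frameBasis h') (Equiv.refl _) 0
    simpa [R, frameBasis] using this
  have hY : R Y = Y' := by
    have := (frameBasis h).equiv_apply_basis (frameBasis h') (Equiv.refl _) 1
    simpa [R, frameBasis] using this
  have hZ : R Z = Z' := by
    have := (frameBasis h).equiv_apply_basis (frameBasis h') (Equiv.refl _) 2
    simpa [R, frameBasis] using this
  -- The determinant of a frame is the triple product of its vectors, here `⟨Z, Z⟩ = 1`. Hence the
  -- rotation, which carries one such frame to another, has determinant `1`.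
  have hdet : ∀ {X Y Z : E3}, Orthonormal ℝ ![X, Y, Z] → cross3 X Y = Z →
      (EuclideanSpace.basisFun (Fin 3) ℝ).toBasis.det ![X, Y, Z] = 1 := by
    intro X Y Z h hc
    obtain ⟨-, -, hZ, -⟩ := orthonormal_three_iff.1 h
    rw [← hZ]
    nth_rw 2 [← hc]
    rw [inner_eq_sum_three, cross3_apply_zero, cross3_apply_one, cross3_apply_two,
      Module.Basis.det_apply, Matrix.det_fin_three]
    simp [Module.Basis.toMatrix_apply]
    ring
  refine ⟨R, ?_, fun z => ?_⟩
  · have h1 := (EuclideanSpace.basisFun (Fin 3) ℝ).toBasis.det_comp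
      (R.toLinearEquiv : E3 →ₗ[ℝ] E3) ![X, Y, Z]
    have h2 : (R.toLinearEquiv : E3 →ₗ[ℝ] E3) ∘ ![X, Y, Z] = ![X', Y', Z'] := by
      ext i : 1
      fin_cases i
      exacts [hX, hY, hZ]
    rw [h2, hdet h hc, hdet h' hc', mul_one] at h1
    exact h1.symm
  · conv_lhs => rw [h.eq_sum_three z]
    simp only [map_add, map_smul, hX, hY, hZ]

end Orthonormal

/-! ### The moving frame system: rigidity of its solutions and the surfaces they define. -/

section SinhGordonFrame

/-- The map `x` with its frame `X, Y, l` of unit principal directions and normal solves the moving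
frame equations of the surface with `√E = -sinh (λ/2)` and `√G = cosh (λ/2)`. -/
structure IsSinhGordonFrame (lam : ℝ × ℝ → ℝ) (X Y l x : ℝ × ℝ → E3) (U : Set (ℝ × ℝ)) : Prop where
  contDiffOn_X : ContDiffOn ℝ ∞ X U
  contDiffOn_Y : ContDiffOn ℝ ∞ Y U
  contDiffOn_l : ContDiffOn ℝ ∞ l U
  contDiffOn_x : ContDiffOn ℝ ∞ x U
  orthonormal : ∀ p ∈ U, Orthonormal ℝ ![X p, Y p, l p]
  cross_eq : ∀ p ∈ U, cross3 (X p) (Y p) = l p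
  Xu : ∀ p ∈ U, partialU X p = (partialV lam p / 2) • Y p + Real.cosh (lam p / 2) • l p
  Xv : ∀ p ∈ U, partialV X p = -(partialU lam p / 2) • Y p
  Yu : ∀ p ∈ U, partialU Y p = -(partialV lam p / 2) • X p
  Yv : ∀ p ∈ U, partialV Y p = (partialU lam p / 2) • X p + -Real.sinh (lam p / 2) • l p
  lu : ∀ p ∈ U, partialU l p = -Real.cosh (lam p / 2) • X p
  lv : ∀ p ∈ U, partialV l p = Real.sinh (lam p / 2) • Y p
  xu : ∀ p ∈ U, partialU x p = -Real.sinh (lam p / 2) • X p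
  xv : ∀ p ∈ U, partialV x p = Real.cosh (lam p / 2) • Y p

variable {lam : ℝ × ℝ → ℝ} {X Y l x X' Y' l' x' : ℝ × ℝ → E3} {U : Set (ℝ × ℝ)}

theorem exists_eq_const_of_partials_eq_zero {F : Type*} [NormedAddCommGroup F] [NormedSpace ℝ F]
    {f : ℝ × ℝ → F} (hU : IsOpen U) (hc : IsPreconnected U)
    (hf : ∀ p ∈ U, DifferentiableAt ℝ f p) (hu : ∀ p ∈ U, partialU f p = 0)
    (hv : ∀ p ∈ U, partialV f p = 0) {p q : ℝ × ℝ} (hp : p ∈ U) (hq : q ∈ U) : f p = f q :=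
  hU.is_const_of_fderiv_eq_zero hc (fun p hp => (hf p hp).differentiableWithinAt)
    (fun p hp => fderiv_eq_zero_of_partials (hu p hp) (hv p hp)) hp hq

/-- Let `R` carry the first frame to the second at one point. Both frames obey the same skew system,
so for fixed `z` the vector `⟨X, z⟩ X' + ⟨Y, z⟩ Y' + ⟨l, z⟩ l'` has zero derivative and remains
equal to `R z` on the connected set. Thus `R` matches the frames everywhere, and `x' - R x` has zero
derivative as well. -/
theorem IsSinhGordonFrame.exists_isMotion (h : IsSinhGordonFrame lam X Y l x U)
    (h' : IsSinhGordonFrame lam X' Y' l' x' U) (hU : IsOpen U) (hc : IsConnected U) :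
    ∃ φ : E3 → E3, IsMotion φ ∧ EqOn x' (φ ∘ x) U := by
  obtain ⟨p₀, hp₀⟩ := hc.nonempty
  obtain ⟨R, hdet, hR⟩ := exists_rotation (h.orthonormal p₀ hp₀) (h'.orthonormal p₀ hp₀)
    (h.cross_eq p₀ hp₀) (h'.cross_eq p₀ hp₀)
  have hRp : ∀ p ∈ U, ∀ z, R z = (inner ℝ (X p) z : ℝ) • X' p + (inner ℝ (Y p) z : ℝ) • Y' p +
      (inner ℝ (l p) z : ℝ) • l' p := by
    intro p hp z
    rw [hR z]
    have hd : ∀ p ∈ U, _ ∧ _ ∧ _ ∧ _ ∧ _ ∧ _ := fun p hp =>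
      ⟨h.contDiffOn_X.differentiableAt_of_isOpen hU hp,
        h.contDiffOn_Y.differentiableAt_of_isOpen hU hp,
        h.contDiffOn_l.differentiableAt_of_isOpen hU hp,
        h'.contDiffOn_X.differentiableAt_of_isOpen hU hp,
        h'.contDiffOn_Y.differentiableAt_of_isOpen hU hp,
        h'.contDiffOn_l.differentiableAt_of_isOpen hU hp⟩
    refine exists_eq_const_of_partials_eq_zero (f := fun p => (inner ℝ (X p) z : ℝ) • X' p +
      (inner ℝ (Y p) z : ℝ) • Y' p + (inner ℝ (l p) z : ℝ) • l' p) hU hc.isPreconnected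
      (fun p hp => ?_) (fun p hp => ?_) (fun p hp => ?_) hp₀ hp
    all_goals
      obtain ⟨hX, hY, hl, hX', hY', hl'⟩ := hd p hp
      have hXz := hX.inner ℝ (differentiableAt_const z)
      have hYz := hY.inner ℝ (differentiableAt_const z)
      have hlz := hl.inner ℝ (differentiableAt_const z)
      have h1 := hXz.fun_smul hX'
      have h2 := hYz.fun_smul hY'
      have h3 := hlz.fun_smul hl'
    · exact (h1.fun_add h2).fun_add h3
    · rw [partialU_add (h1.fun_add h2) h3, partialU_add h1 h2, partialU_smul hXz hX',
        partialU_smul hYz hY', partialU_smul hlz hl', partialU_inner hX (differentiableAt_const z),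
        partialU_inner hY (differentiableAt_const z), partialU_inner hl (differentiableAt_const z),
        h.Xu p hp, h.Yu p hp, h.lu p hp, h'.Xu p hp, h'.Yu p hp, h'.lu p hp, partialU_const]
      simp only [inner_zero_right, inner_add_left, real_inner_smul_left]
      module
    · rw [partialV_add (h1.fun_add h2) h3, partialV_add h1 h2, partialV_smul hXz hX',
        partialV_smul hYz hY', partialV_smul hlz hl', partialV_inner hX (differentiableAt_const z),
        partialV_inner hY (differentiableAt_const z), partialV_inner hl (differentiableAt_const z),
        h.Xv p hp, h.Yv p hp, h.lv p hp, h'.Xv p hp, h'.Yv p hp, h'.lv p hp, partialV_const]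
      simp only [inner_zero_right, inner_add_left, real_inner_smul_left]
      module
  have hRX : ∀ p ∈ U, R (X p) = X' p ∧ R (Y p) = Y' p := by
    intro p hp
    obtain ⟨hX, hY, -, hXY, hXl, hYl⟩ := orthonormal_three_iff.1 (h.orthonormal p hp)
    rw [hRp p hp, hRp p hp, hX, hY, hXY, real_inner_comm, hXY, real_inner_comm, hXl,
      real_inner_comm (Y p) (l p), hYl]
    constructor <;> module
  refine ⟨fun z => R z + (x' p₀ - R (x p₀)), ⟨R, _, hdet, fun z => rfl⟩, fun p hp => ?_⟩
  let T : E3 →L[ℝ] E3 := -(R.toContinuousLinearEquiv : E3 →L[ℝ] E3)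
  have hT : ∀ z, T z = -R z := fun z => rfl
  have hconst : x' p + T (x p) = x' p₀ + T (x p₀) := by
    have hx := fun p hp => h.contDiffOn_x.differentiableAt_of_isOpen hU (p := p) hp
    have hx' := fun p hp => h'.contDiffOn_x.differentiableAt_of_isOpen hU (p := p) hp
    have hTx : ∀ p ∈ U, DifferentiableAt ℝ (fun p => T (x p)) p := fun p hp =>
      T.differentiableAt.comp p (hx p hp)
    refine exists_eq_const_of_partials_eq_zero (f := fun p => x' p + T (x p)) hU hc.isPreconnected
      (fun p hp => (hx' p hp).add (hTx p hp)) (fun p hp => ?_) (fun p hp => ?_) hp hp₀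
    · rw [partialU_add (hx' p hp) (hTx p hp), partialU_clm T (hx p hp), h.xu p hp, h'.xu p hp, hT,
        map_smul, (hRX p hp).1]
      module
    · rw [partialV_add (hx' p hp) (hTx p hp), partialV_clm T (hx p hp), h.xv p hp, h'.xv p hp, hT,
        map_smul, (hRX p hp).2]
      module
  rw [hT, hT] at hconst
  simp only [Function.comp_apply]
  rw [eq_sub_of_add_eq hconst]
  abel

theorem partialU_neg_sinh_half {p : ℝ × ℝ} (hlam : DifferentiableAt ℝ lam p) :
    partialU (fun q => -Real.sinh (lam q / 2)) p =
      -(Real.cosh (lam p / 2) * (partialU lam p / 2)) := by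
  rw [partialU_comp (h := fun t => -Real.sinh (t / 2))
    (((hasDerivAt_id (lam p)).div_const 2).sinh.neg) hlam]
  simp; ring

theorem partialV_neg_sinh_half {p : ℝ × ℝ} (hlam : DifferentiableAt ℝ lam p) :
    partialV (fun q => -Real.sinh (lam q / 2)) p =
      -(Real.cosh (lam p / 2) * (partialV lam p / 2)) := by
  rw [partialV_comp (h := fun t => -Real.sinh (t / 2))
    (((hasDerivAt_id (lam p)).div_const 2).sinh.neg) hlam]
  simp; ring

theorem partialU_cosh_half {p : ℝ × ℝ} (hlam : DifferentiableAt ℝ lam p) :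
    partialU (fun q => Real.cosh (lam q / 2)) p = Real.sinh (lam p / 2) * (partialU lam p / 2) := by
  rw [partialU_comp (h := fun t => Real.cosh (t / 2))
    (((hasDerivAt_id (lam p)).div_const 2).cosh) hlam]
  simp; ring

theorem partialV_cosh_half {p : ℝ × ℝ} (hlam : DifferentiableAt ℝ lam p) :
    partialV (fun q => Real.cosh (lam q / 2)) p = Real.sinh (lam p / 2) * (partialV lam p / 2) := by
  rw [partialV_comp (h := fun t => Real.cosh (t / 2))
    (((hasDerivAt_id (lam p)).div_const 2).cosh) hlam]
  simp; ring

theorem differentiableAt_neg_sinh_half {p : ℝ × ℝ} (hlam : DifferentiableAt ℝ lam p) :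
    DifferentiableAt ℝ (fun q => -Real.sinh (lam q / 2)) p := by fun_prop

theorem differentiableAt_cosh_half {p : ℝ × ℝ} (hlam : DifferentiableAt ℝ lam p) :
    DifferentiableAt ℝ (fun q => Real.cosh (lam q / 2)) p := by fun_prop

theorem unitNormal_eq_of_smul {x : ℝ × ℝ → E3} {p : ℝ × ℝ} {a b : ℝ} {X Y l : E3} (ha : 0 < a)
    (hb : 0 < b) (h : Orthonormal ℝ ![X, Y, l]) (hc : cross3 X Y = l) (hu : partialU x p = a • X)
    (hv : partialV x p = b • Y) : unitNormal x p = l := by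
  have hl : ‖l‖ = 1 := h.1 2
  rw [unitNormal, hu, hv, cross3_smul_smul, hc, norm_smul, hl, mul_one, Real.norm_eq_abs,
    abs_of_pos (by positivity), smul_smul, inv_mul_cancel₀ (by positivity), one_smul]

/-- The frame equations give `E = sinh² (λ/2)`, `G = cosh² (λ/2)`, `F = M = 0` and `L = N = -sinh
(λ/2) cosh (λ/2)`, from which all invariants follow. The sign of `λ` makes `-sinh (λ/2)` the
positive root of `E` and makes `l` the unit normal. -/
theorem IsSinhGordonFrame.isSurfaceGeneratedBy (h : IsSinhGordonFrame lam X Y l x U)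
    (hU : IsOpen U) (hlam : ContDiffOn ℝ ∞ lam U) (hneg : ∀ p ∈ U, lam p < 0)
    (hne : ∀ p ∈ U, partialU lam p * partialV lam p ≠ 0) : IsSurfaceGeneratedBy lam x U := by
  have hs : ∀ p ∈ U, 0 < -Real.sinh (lam p / 2) := fun p hp => by
    rw [neg_pos, Real.sinh_neg_iff]; linarith [hneg p hp]
  have hc : ∀ p, 0 < Real.cosh (lam p / 2) := fun p => Real.cosh_pos _
  have hlamd := fun p hp => hlam.differentiableAt_of_isOpen hU (p := p) hp
  have hE : ∀ p ∈ U, coeffE x p = -Real.sinh (lam p / 2) * -Real.sinh (lam p / 2) := by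
    intro p hp
    obtain ⟨hX, -⟩ := orthonormal_three_iff.1 (h.orthonormal p hp)
    rw [coeffE, h.xu p hp, real_inner_smul_left, real_inner_smul_right, hX, mul_one]
  have hF : ∀ p ∈ U, coeffF x p = 0 := by
    intro p hp
    obtain ⟨-, -, -, hXY, -⟩ := orthonormal_three_iff.1 (h.orthonormal p hp)
    rw [coeffF, h.xu p hp, h.xv p hp, real_inner_smul_left, real_inner_smul_right, hXY]
    simp
  have hG : ∀ p ∈ U, coeffG x p = Real.cosh (lam p / 2) * Real.cosh (lam p / 2) := by
    intro p hp
    obtain ⟨-, hY, -⟩ := orthonormal_three_iff.1 (h.orthonormal p hp)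
    rw [coeffG, h.xv p hp, real_inner_smul_left, real_inner_smul_right, hY, mul_one]
  have hn : ∀ p ∈ U, unitNormal x p = l p := fun p hp =>
    unitNormal_eq_of_smul (hs p hp) (hc p) (h.orthonormal p hp) (h.cross_eq p hp) (h.xu p hp)
      (h.xv p hp)
  have hXd := fun p hp => h.contDiffOn_X.differentiableAt_of_isOpen hU (p := p) hp
  have hYd := fun p hp => h.contDiffOn_Y.differentiableAt_of_isOpen hU (p := p) hp
  have hL : ∀ p ∈ U, coeffL x p = -Real.sinh (lam p / 2) * Real.cosh (lam p / 2) := by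
    intro p hp
    obtain ⟨hX, hY, hl, hXY, hXl, hYl⟩ := orthonormal_three_iff.1 (h.orthonormal p hp)
    rw [coeffL, hn p hp, partialU_congr_of_isOpen hU h.xu hp,
      partialU_smul (differentiableAt_neg_sinh_half (hlamd p hp)) (hXd p hp), h.Xu p hp]
    simp only [inner_add_left, real_inner_smul_left, hXl, hYl, hl]
    ring
  have hM : ∀ p ∈ U, coeffM x p = 0 := by
    intro p hp
    obtain ⟨hX, hY, hl, hXY, hXl, hYl⟩ := orthonormal_three_iff.1 (h.orthonormal p hp)
    rw [coeffM, hn p hp, partialV_congr_of_isOpen hU h.xu hp,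
      partialV_smul (differentiableAt_neg_sinh_half (hlamd p hp)) (hXd p hp), h.Xv p hp]
    simp only [inner_add_left, real_inner_smul_left, hXl, hYl]
    ring
  have hN : ∀ p ∈ U, coeffN x p = -Real.sinh (lam p / 2) * Real.cosh (lam p / 2) := by
    intro p hp
    obtain ⟨hX, hY, hl, hXY, hXl, hYl⟩ := orthonormal_three_iff.1 (h.orthonormal p hp)
    rw [coeffN, hn p hp, partialV_congr_of_isOpen hU h.xv hp,
      partialV_smul (differentiableAt_cosh_half (hlamd p hp)) (hYd p hp), h.Yv p hp]
    simp only [inner_add_left, real_inner_smul_left, hXl, hYl, hl]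
    ring
  have hs0 : ∀ p ∈ U, Real.sinh (lam p / 2) ≠ 0 := fun p hp => (neg_pos.1 (hs p hp)).ne
  have hν₁ : ∀ p ∈ U, nu1 x p = -(Real.cosh (lam p / 2) / Real.sinh (lam p / 2)) := by
    intro p hp
    have := hs0 p hp
    rw [nu1, hL p hp, hE p hp]
    field_simp
  have hν₂ : ∀ p ∈ U, nu2 x p = -Real.tanh (lam p / 2) := by
    intro p hp
    have := (hc p).ne'
    rw [nu2, hN p hp, hG p hp, Real.tanh_eq_sinh_div_cosh]
    field_simp
  have hγ₁ : ∀ p ∈ U, gamma1 x p = -(partialV lam p / (2 * Real.sinh (lam p / 2))) := by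
    intro p hp
    have h1 := hs0 p hp
    have h2 := (hc p).ne'
    have hd := differentiableAt_neg_sinh_half (hlamd p hp)
    rw [gamma1, partialV_congr_of_isOpen hU hE hp, partialV_mul hd hd,
      partialV_neg_sinh_half (hlamd p hp), hE p hp, hG p hp, Real.sqrt_mul_self (hc p).le]
    field_simp
    ring
  have hγ₂ : ∀ p ∈ U, gamma2 x p = -(partialU lam p / (2 * Real.cosh (lam p / 2))) := by
    intro p hp
    have h1 := hs0 p hp
    have h2 := (hc p).ne'
    have hd := differentiableAt_cosh_half (hlamd p hp)
    rw [gamma2, partialU_congr_of_isOpen hU hG hp, partialU_mul hd hd,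
      partialU_cosh_half (hlamd p hp), hE p hp, hG p hp, Real.sqrt_mul_self (hs p hp).le]
    field_simp
    ring
  refine ⟨⟨⟨hU, h.contDiffOn_x, fun p hp => ?_, hF, hM⟩, fun p hp => ?_⟩, fun p hp => ?_,
    hν₁, hν₂, hγ₁, hγ₂⟩
  · have h1 : LinearIndependent ℝ ![X p, Y p] := by
      have := (h.orthonormal p hp).linearIndependent.comp ![0, 1] (by decide)
      have heq : ![X p, Y p, l p] ∘ ![0, 1] = ![X p, Y p] := by
        ext i : 1
        fin_cases i <;> rfl
      rwa [heq] at this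
    rw [LinearIndependent.pair_iff] at h1 ⊢
    intro s t hst
    rw [h.xu p hp, h.xv p hp, smul_smul, smul_smul] at hst
    obtain ⟨h2, h3⟩ := h1 _ _ hst
    exact ⟨(mul_eq_zero.1 h2).resolve_right (hs p hp).ne',
      (mul_eq_zero.1 h3).resolve_right (hc p).ne'⟩
  · rw [hν₁ p hp, hν₂ p hp, hγ₁ p hp, hγ₂ p hp]
    have h1 := hs0 p hp
    have h2 := (hc p).ne'
    -- By `cosh² - sinh² = 1` the difference of the principal curvatures is a reciprocal, hence
    -- nonzero; `γ₁` and `γ₂` are nonzero because `λ_v` and `λ_u` are.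
    have h3 : -(Real.cosh (lam p / 2) / Real.sinh (lam p / 2)) - -Real.tanh (lam p / 2) =
        -(1 / (Real.sinh (lam p / 2) * Real.cosh (lam p / 2))) := by
      rw [Real.tanh_eq_sinh_div_cosh]
      field_simp
      linarith [Real.cosh_sq (lam p / 2)]
    rw [h3]
    have h4 := left_ne_zero_of_mul (hne p hp)
    have h5 := right_ne_zero_of_mul (hne p hp)
    have : (1 : ℝ) / (Real.sinh (lam p / 2) * Real.cosh (lam p / 2)) ≠ 0 := by positivity
    refine mul_ne_zero (mul_ne_zero (neg_ne_zero.2 this) (neg_ne_zero.2 ?_)) (neg_ne_zero.2 ?_)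
    · exact div_ne_zero h5 (by positivity)
    · exact div_ne_zero h4 (by positivity)
  · have h1 := hs0 p hp
    have h2 := (hc p).ne'
    rw [gaussCurvature, hL p hp, hM p hp, hN p hp, hE p hp, hF p hp, hG p hp]
    field_simp

end SinhGordonFrame

/-! ### Gauss–Weingarten and Codazzi equations, and recovery of the metric from the invariants. -/

section PrincipalFrame

/-- A surface in principal parameters with `x_u = a X` and `x_v = b Y` for a right-handed
orthonormal frame `X, Y, l` and positive functions `a, b`; its principal curvatures are `ν₁` and
`ν₂`. -/
structure IsPrincipalFrame (a b ν₁ ν₂ : ℝ × ℝ → ℝ) (X Y l x : ℝ × ℝ → E3) (U : Set (ℝ × ℝ)) :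
    Prop where
  isOpen : IsOpen U
  contDiffOn_X : ContDiffOn ℝ ∞ X U
  contDiffOn_Y : ContDiffOn ℝ ∞ Y U
  contDiffOn_l : ContDiffOn ℝ ∞ l U
  contDiffOn_x : ContDiffOn ℝ ∞ x U
  contDiffOn_a : ContDiffOn ℝ ∞ a U
  contDiffOn_b : ContDiffOn ℝ ∞ b U
  a_pos : ∀ p ∈ U, 0 < a p
  b_pos : ∀ p ∈ U, 0 < b p
  orthonormal : ∀ p ∈ U, Orthonormal ℝ ![X p, Y p, l p]
  cross_eq : ∀ p ∈ U, cross3 (X p) (Y p) = l p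
  xu : ∀ p ∈ U, partialU x p = a p • X p
  xv : ∀ p ∈ U, partialV x p = b p • Y p
  xuu : ∀ p ∈ U, inner ℝ (partialU (partialU x) p) (l p) = a p * a p * ν₁ p
  xuv : ∀ p ∈ U, inner ℝ (partialV (partialU x) p) (l p) = (0 : ℝ)
  xvv : ∀ p ∈ U, inner ℝ (partialV (partialV x) p) (l p) = b p * b p * ν₂ p

variable {a b ν₁ ν₂ : ℝ × ℝ → ℝ} {X Y l x f g : ℝ × ℝ → E3} {U : Set (ℝ × ℝ)} {p : ℝ × ℝ}

/-- Differentiating the constant `⟨f, g⟩` gives the skew symmetry of the connection coefficients of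
an orthonormal frame. -/
theorem inner_partials_of_inner_const (hU : IsOpen U) (hp : p ∈ U) (hf : ContDiffOn ℝ ∞ f U)
    (hg : ContDiffOn ℝ ∞ g U) {c : ℝ} (h : ∀ q ∈ U, inner ℝ (f q) (g q) = c) :
    inner ℝ (g p) (partialU f p) = -(inner ℝ (f p) (partialU g p) : ℝ) ∧
      inner ℝ (g p) (partialV f p) = -(inner ℝ (f p) (partialV g p) : ℝ) := by
  have hf' := hf.differentiableAt_of_isOpen hU hp
  have hg' := hg.differentiableAt_of_isOpen hU hp
  have h1 := partialU_congr_of_isOpen (g := fun _ => c) hU h hp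
  have h2 := partialV_congr_of_isOpen (g := fun _ => c) hU h hp
  rw [partialU_const, partialU_inner hf' hg'] at h1
  rw [partialV_const, partialV_inner hf' hg'] at h2
  rw [real_inner_comm, real_inner_comm (partialV f p)]
  constructor <;> linarith

/-- The equations of Gauss and Weingarten for a principal frame. -/
theorem IsPrincipalFrame.structure_equations (h : IsPrincipalFrame a b ν₁ ν₂ X Y l x U)
    (hp : p ∈ U) :
    partialU X p = -(partialV a p / b p) • Y p + (a p * ν₁ p) • l p ∧
    partialV X p = (partialU b p / a p) • Y p ∧
    partialU Y p = (partialV a p / b p) • X p ∧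
    partialV Y p = -(partialU b p / a p) • X p + (b p * ν₂ p) • l p ∧
    partialU l p = -(a p * ν₁ p) • X p ∧ partialV l p = -(b p * ν₂ p) • Y p := by
  have hU := h.isOpen
  have ha := (h.a_pos p hp).ne'
  have hb := (h.b_pos p hp).ne'
  have hort := fun q hq => orthonormal_three_iff.1 (h.orthonormal q hq)
  obtain ⟨hXX, hYY, hll, hXY, hXl, hYl⟩ := hort p hp
  have had := h.contDiffOn_a.differentiableAt_of_isOpen hU hp
  have hbd := h.contDiffOn_b.differentiableAt_of_isOpen hU hp
  have hXd := h.contDiffOn_X.differentiableAt_of_isOpen hU hp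
  have hYd := h.contDiffOn_Y.differentiableAt_of_isOpen hU hp
  have hYX : inner ℝ (Y p) (X p) = (0 : ℝ) := (real_inner_comm _ _).trans hXY
  have hlX : inner ℝ (l p) (X p) = (0 : ℝ) := (real_inner_comm _ _).trans hXl
  have hlY : inner ℝ (l p) (Y p) = (0 : ℝ) := (real_inner_comm _ _).trans hYl
  have cXX := inner_partials_of_inner_const hU hp h.contDiffOn_X h.contDiffOn_X
    fun q hq => (hort q hq).1
  have cYY := inner_partials_of_inner_const hU hp h.contDiffOn_Y h.contDiffOn_Y
    fun q hq => (hort q hq).2.1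
  have cll := inner_partials_of_inner_const hU hp h.contDiffOn_l h.contDiffOn_l
    fun q hq => (hort q hq).2.2.1
  have cXY := inner_partials_of_inner_const hU hp h.contDiffOn_X h.contDiffOn_Y
    fun q hq => (hort q hq).2.2.2.1
  have cXl := inner_partials_of_inner_const hU hp h.contDiffOn_X h.contDiffOn_l
    fun q hq => (hort q hq).2.2.2.2.1
  have cYl := inner_partials_of_inner_const hU hp h.contDiffOn_Y h.contDiffOn_l
    fun q hq => (hort q hq).2.2.2.2.2
  have e1 : partialU (partialU x) p = a p • partialU X p + partialU a p • X p := by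
    rw [partialU_congr_of_isOpen hU h.xu hp, partialU_smul had hXd]
  have e2 : partialV (partialU x) p = a p • partialV X p + partialV a p • X p := by
    rw [partialV_congr_of_isOpen hU h.xu hp, partialV_smul had hXd]
  have e3 : partialV (partialU x) p = b p • partialU Y p + partialU b p • Y p := by
    rw [partialV_partialU_comm h.contDiffOn_x hU hp, partialU_congr_of_isOpen hU h.xv hp,
      partialU_smul hbd hYd]
  have e4 : partialV (partialV x) p = b p • partialV Y p + partialV b p • Y p := by
    rw [partialV_congr_of_isOpen hU h.xv hp, partialV_smul hbd hYd]
  have lXu : inner ℝ (l p) (partialU X p) = a p * ν₁ p := by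
    have := h.xuu p hp
    rw [real_inner_comm, e1, inner_add_right, real_inner_smul_right, real_inner_smul_right, hlX]
      at this
    refine mul_left_cancel₀ ha ?_
    linarith
  have lXv : inner ℝ (l p) (partialV X p) = (0 : ℝ) := by
    have := h.xuv p hp
    rw [real_inner_comm, e2, inner_add_right, real_inner_smul_right, real_inner_smul_right, hlX]
      at this
    refine mul_left_cancel₀ ha ?_
    linarith
  have lYu : inner ℝ (l p) (partialU Y p) = (0 : ℝ) := by
    have := h.xuv p hp
    rw [real_inner_comm, e3, inner_add_right, real_inner_smul_right, real_inner_smul_right, hlY]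
      at this
    refine mul_left_cancel₀ hb ?_
    linarith
  have lYv : inner ℝ (l p) (partialV Y p) = b p * ν₂ p := by
    have := h.xvv p hp
    rw [real_inner_comm, e4, inner_add_right, real_inner_smul_right, real_inner_smul_right, hlY]
      at this
    refine mul_left_cancel₀ hb ?_
    linarith
  have YYu : inner ℝ (Y p) (partialU Y p) = (0 : ℝ) := by linarith [cYY.1]
  have YYv : inner ℝ (Y p) (partialV Y p) = (0 : ℝ) := by linarith [cYY.2]
  have XXu : inner ℝ (X p) (partialU X p) = (0 : ℝ) := by linarith [cXX.1]
  have XXv : inner ℝ (X p) (partialV X p) = (0 : ℝ) := by linarith [cXX.2]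
  have llu : inner ℝ (l p) (partialU l p) = (0 : ℝ) := by linarith [cll.1]
  have llv : inner ℝ (l p) (partialV l p) = (0 : ℝ) := by linarith [cll.2]
  -- The tangential coefficients come from the symmetry `x_uv = x_vu`, that is `a X_v + a_v X = b
  -- Y_u + b_u Y`, paired with `Y` here and with `X` next.
  have YXv : inner ℝ (Y p) (partialV X p) = partialU b p / a p := by
    have := congrArg (fun z => (inner ℝ (Y p) z : ℝ)) (e2.symm.trans e3)
    simp only [inner_add_right, real_inner_smul_right, hYX, YYu, hYY] at this
    rw [eq_div_iff ha]
    linarith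
  have XYu : inner ℝ (X p) (partialU Y p) = partialV a p / b p := by
    have := congrArg (fun z => (inner ℝ (X p) z : ℝ)) (e2.symm.trans e3)
    simp only [inner_add_right, real_inner_smul_right, hXY, XXv, hXX] at this
    rw [eq_div_iff hb]
    linarith
  have hexp := fun w => (h.orthonormal p hp).eq_sum_three w
  refine ⟨?_, ?_, ?_, ?_, ?_, ?_⟩
  · rw [hexp (partialU X p), XXu, cXY.1, XYu, lXu]; module
  · rw [hexp (partialV X p), XXv, YXv, lXv]; module
  · rw [hexp (partialU Y p), XYu, YYu, lYu]; module
  · rw [hexp (partialV Y p), YYv, lYv, ← YXv, cXY.2]; module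
  · have hX : inner ℝ (X p) (partialU l p) = -(a p * ν₁ p) := by linarith [cXl.1]
    have hY : inner ℝ (Y p) (partialU l p) = (0 : ℝ) := by linarith [cYl.1]
    rw [hexp (partialU l p), llu, hX, hY]; module
  · have hX : inner ℝ (X p) (partialV l p) = (0 : ℝ) := by linarith [cXl.2]
    have hY : inner ℝ (Y p) (partialV l p) = -(b p * ν₂ p) := by linarith [cYl.2]
    rw [hexp (partialV l p), llv, hX, hY]; module

/-- The equations of Codazzi for a principal frame. -/
theorem IsPrincipalFrame.codazzi (h : IsPrincipalFrame a b ν₁ ν₂ X Y l x U) (hp : p ∈ U)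
    (h₁ : DifferentiableAt ℝ ν₁ p) (h₂ : DifferentiableAt ℝ ν₂ p) :
    a p * partialV ν₁ p = partialV a p * (ν₂ p - ν₁ p) ∧
      b p * partialU ν₂ p = partialU b p * (ν₁ p - ν₂ p) := by
  have hU := h.isOpen
  have ha := (h.a_pos p hp).ne'
  have hb := (h.b_pos p hp).ne'
  obtain ⟨hXX, hYY, -, hXY, -, -⟩ := orthonormal_three_iff.1 (h.orthonormal p hp)
  have hYX : inner ℝ (Y p) (X p) = (0 : ℝ) := (real_inner_comm _ _).trans hXY
  have had := h.contDiffOn_a.differentiableAt_of_isOpen hU hp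
  have hbd := h.contDiffOn_b.differentiableAt_of_isOpen hU hp
  have hXd := h.contDiffOn_X.differentiableAt_of_isOpen hU hp
  have hYd := h.contDiffOn_Y.differentiableAt_of_isOpen hU hp
  obtain ⟨-, hXv, hYu, -, -, -⟩ := h.structure_equations hp
  -- Codazzi is the symmetry `l_uv = l_vu` with `l_u = -a ν₁ X` and `l_v = -b ν₂ Y`; the `X`
  -- component gives the first equation, the `Y` component the second.
  have e := partialV_partialU_comm h.contDiffOn_l hU hp
  have e1 : EqOn (partialU l) (fun q => (a q * ν₁ q) • -X q) U := fun q hq => by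
    rw [(h.structure_equations hq).2.2.2.2.1]; module
  have e2 : EqOn (partialV l) (fun q => (b q * ν₂ q) • -Y q) U := fun q hq => by
    rw [(h.structure_equations hq).2.2.2.2.2]; module
  have hXn : partialV (fun q => -X q) p = -partialV X p := by simp [partialV, fderiv_fun_neg]
  have hYn : partialU (fun q => -Y q) p = -partialU Y p := by simp [partialU, fderiv_fun_neg]
  rw [partialV_congr_of_isOpen hU e1 hp, partialU_congr_of_isOpen hU e2 hp,
    partialV_smul (had.fun_mul h₁) hXd.fun_neg,
    partialU_smul (hbd.fun_mul h₂) hYd.fun_neg, hXn, hYn,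
    partialV_mul had h₁, partialU_mul hbd h₂, hXv, hYu] at e
  constructor
  · have := congrArg (fun z => (inner ℝ (X p) z : ℝ)) e
    simp only [inner_add_right, inner_neg_right, real_inner_smul_right, hXX, hXY] at this
    field_simp at this
    linarith
  · have := congrArg (fun z => (inner ℝ (Y p) z : ℝ)) e
    simp only [inner_add_right, inner_neg_right, real_inner_smul_right, hYY, hYX] at this
    field_simp at this
    linarith

/-- Since `F = 0`, normalising `x_u` and `x_v` already gives an orthonormal pair, and its vector
product is the unit normal because the scale factors are positive. -/
theorem IsPrincipalSurface.exists_isPrincipalFrame (h : IsPrincipalSurface x U) :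
    ∃ X Y l : ℝ × ℝ → E3, IsPrincipalFrame (fun p => √(coeffE x p)) (fun p => √(coeffG x p))
      (nu1 x) (nu2 x) X Y l x U := by
  have hU := h.isOpen
  have hxu := h.smooth.partialU hU
  have hxv := h.smooth.partialV hU
  have hE : ∀ p ∈ U, 0 < coeffE x p := fun p hp =>
    real_inner_self_pos.2 (by simpa using (h.regular p hp).ne_zero 0)
  have hG : ∀ p ∈ U, 0 < coeffG x p := fun p hp =>
    real_inner_self_pos.2 (by simpa using (h.regular p hp).ne_zero 1)
  have hEs : ContDiffOn ℝ ∞ (fun p => √(coeffE x p)) U :=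
    (hxu.inner ℝ hxu).sqrt fun p hp => (hE p hp).ne'
  have hGs : ContDiffOn ℝ ∞ (fun p => √(coeffG x p)) U :=
    (hxv.inner ℝ hxv).sqrt fun p hp => (hG p hp).ne'
  have hXs : ContDiffOn ℝ ∞ (fun p => (√(coeffE x p))⁻¹ • partialU x p) U :=
    (hEs.inv fun p hp => (Real.sqrt_pos.2 (hE p hp)).ne').smul hxu
  have hYs : ContDiffOn ℝ ∞ (fun p => (√(coeffG x p))⁻¹ • partialV x p) U :=
    (hGs.inv fun p hp => (Real.sqrt_pos.2 (hG p hp)).ne').smul hxv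
  have hort : ∀ p ∈ U, Orthonormal ℝ ![(√(coeffE x p))⁻¹ • partialU x p,
      (√(coeffG x p))⁻¹ • partialV x p,
      cross3 ((√(coeffE x p))⁻¹ • partialU x p) ((√(coeffG x p))⁻¹ • partialV x p)] := by
    intro p hp
    have h1 := (Real.sqrt_pos.2 (hE p hp)).ne'
    have h2 := (Real.sqrt_pos.2 (hG p hp)).ne'
    have h3 := Real.sq_sqrt (hE p hp).le
    have h4 := Real.sq_sqrt (hG p hp).le
    apply orthonormal_cross3
    · rw [real_inner_smul_left, real_inner_smul_right]
      change (√(coeffE x p))⁻¹ * ((√(coeffE x p))⁻¹ * coeffE x p) = 1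
      field_simp
      exact h3.symm
    · rw [real_inner_smul_left, real_inner_smul_right]
      change (√(coeffG x p))⁻¹ * ((√(coeffG x p))⁻¹ * coeffG x p) = 1
      field_simp
      exact h4.symm
    · rw [real_inner_smul_left, real_inner_smul_right]
      change (√(coeffE x p))⁻¹ * ((√(coeffG x p))⁻¹ * coeffF x p) = 0
      rw [h.coeffF_eq_zero p hp, mul_zero, mul_zero]
  have hu : ∀ p ∈ U, partialU x p = √(coeffE x p) • (√(coeffE x p))⁻¹ • partialU x p :=
    fun p hp => by rw [smul_inv_smul₀ (Real.sqrt_pos.2 (hE p hp)).ne']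
  have hv : ∀ p ∈ U, partialV x p = √(coeffG x p) • (√(coeffG x p))⁻¹ • partialV x p :=
    fun p hp => by rw [smul_inv_smul₀ (Real.sqrt_pos.2 (hG p hp)).ne']
  have hn : ∀ p ∈ U, unitNormal x p = cross3 ((√(coeffE x p))⁻¹ • partialU x p)
      ((√(coeffG x p))⁻¹ • partialV x p) := fun p hp =>
    unitNormal_eq_of_smul (Real.sqrt_pos.2 (hE p hp)) (Real.sqrt_pos.2 (hG p hp)) (hort p hp) rfl
      (hu p hp) (hv p hp)
  refine ⟨_, _, _, hU, hXs, hYs, hXs.cross3 hYs, h.smooth, hEs, hGs,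
    fun p hp => Real.sqrt_pos.2 (hE p hp), fun p hp => Real.sqrt_pos.2 (hG p hp), hort,
    fun p hp => rfl, hu, hv, fun p hp => ?_, fun p hp => ?_, fun p hp => ?_⟩
  · rw [← hn p hp, Real.mul_self_sqrt (hE p hp).le, nu1, mul_div_cancel₀ _ (hE p hp).ne']
    rfl
  · rw [← hn p hp]
    exact h.coeffM_eq_zero p hp
  · rw [← hn p hp, Real.mul_self_sqrt (hG p hp).le, nu2, mul_div_cancel₀ _ (hG p hp).ne']
    rfl

variable {lam : ℝ × ℝ → ℝ}

/-- By the equations of Codazzi, the invariants of the surface determine `√E` and `√G`. -/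
theorem IsPrincipalFrame.eq_of_invariants (h : IsPrincipalFrame a b ν₁ ν₂ X Y l x U)
    (hlam : DifferentiableAt ℝ lam p) (hp : p ∈ U) (hneg : lam p < 0)
    (hne : partialU lam p * partialV lam p ≠ 0)
    (h₁ : ∀ p ∈ U, ν₁ p = -(Real.cosh (lam p / 2) / Real.sinh (lam p / 2)))
    (h₂ : ∀ p ∈ U, ν₂ p = -Real.tanh (lam p / 2))
    (hγ₁ : -(partialV a p / (a p * b p)) = -(partialV lam p / (2 * Real.sinh (lam p / 2))))
    (hγ₂ : partialU b p / (a p * b p) = -(partialU lam p / (2 * Real.cosh (lam p / 2)))) :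
    a p = -Real.sinh (lam p / 2) ∧ b p = Real.cosh (lam p / 2) := by
  have hU := h.isOpen
  have ha := (h.a_pos p hp).ne'
  have hb := (h.b_pos p hp).ne'
  have hs : Real.sinh (lam p / 2) ≠ 0 := Real.sinh_ne_zero.2 (by linarith)
  have hc : Real.cosh (lam p / 2) ≠ 0 := (Real.cosh_pos _).ne'
  have hcs := Real.cosh_sq (lam p / 2)
  have hlu := left_ne_zero_of_mul hne
  have hlv := right_ne_zero_of_mul hne
  have hhalf := (hasDerivAt_id (lam p)).div_const 2
  have d₁ : HasDerivAt (fun t => -(Real.cosh (t / 2) / Real.sinh (t / 2)))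
      (1 / (2 * Real.sinh (lam p / 2) ^ 2)) (lam p) := by
    refine (hhalf.cosh.fun_div hhalf.sinh hs).fun_neg.congr_deriv ?_
    simp only [id]
    field_simp
    linarith
  have d₂ : HasDerivAt (fun t => -Real.tanh (t / 2))
      (-(1 / (2 * Real.cosh (lam p / 2) ^ 2))) (lam p) := by
    simp only [Real.tanh_eq_sinh_div_cosh]
    refine (hhalf.sinh.fun_div hhalf.cosh hc).fun_neg.congr_deriv ?_
    simp only [id]
    field_simp
    linarith
  have ev₁ := EqOn.eventuallyEq_of_mem h₁ (hU.mem_nhds hp)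
  have ev₂ := EqOn.eventuallyEq_of_mem h₂ (hU.mem_nhds hp)
  obtain ⟨hcod₁, hcod₂⟩ := h.codazzi hp
    ((d₁.comp_hasFDerivAt p hlam.hasFDerivAt).differentiableAt.congr_of_eventuallyEq ev₁)
    ((d₂.comp_hasFDerivAt p hlam.hasFDerivAt).differentiableAt.congr_of_eventuallyEq ev₂)
  rw [partialV_congr ev₁, partialV_comp d₁ hlam, h₁ p hp, h₂ p hp, Real.tanh_eq_sinh_div_cosh]
    at hcod₁
  rw [partialU_congr ev₂, partialU_comp d₂ hlam, h₁ p hp, h₂ p hp, Real.tanh_eq_sinh_div_cosh]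
    at hcod₂
  have hdiff : -(Real.cosh (lam p / 2) / Real.sinh (lam p / 2)) -
      -(Real.sinh (lam p / 2) / Real.cosh (lam p / 2)) =
        -(1 / (Real.sinh (lam p / 2) * Real.cosh (lam p / 2))) := by
    field_simp
    linarith
  rw [hdiff] at hcod₂
  rw [← neg_sub, hdiff, neg_neg] at hcod₁
  -- The prescribed `γ₁` and `γ₂` make `a_v` and `b_u` known multiples of `a b`. In the first
  -- Codazzi equation `a` and `λ_v` then cancel and determine `b`; in the second `b` and `λ_u`
  -- cancel and determine `a`.
  have hav : partialV a p = partialV lam p / (2 * Real.sinh (lam p / 2)) * (a p * b p) := by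
    rw [← neg_inj.1 hγ₁]; field_simp
  have hbu : partialU b p = -(partialU lam p / (2 * Real.cosh (lam p / 2))) * (a p * b p) := by
    rw [← hγ₂]; field_simp
  rw [hav] at hcod₁
  rw [hbu] at hcod₂
  field_simp at hcod₁ hcod₂
  constructor
  · linarith
  · linarith

/-- Once `√E` and `√G` are known functions of `λ`, every coefficient in the Gauss–Weingarten
equations is too, and the principal frame solves the system determined by `λ` alone. -/
theorem IsSurfaceGeneratedBy.exists_isSinhGordonFrame (h : IsSurfaceGeneratedBy lam x U)
    (hlam : ContDiffOn ℝ ∞ lam U) (hneg : ∀ p ∈ U, lam p < 0)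
    (hne : ∀ p ∈ U, partialU lam p * partialV lam p ≠ 0) :
    ∃ X Y l : ℝ × ℝ → E3, IsSinhGordonFrame lam X Y l x U := by
  have hU := h.stronglyRegular.isOpen
  obtain ⟨X, Y, l, hf⟩ := h.stronglyRegular.toIsPrincipalSurface.exists_isPrincipalFrame
  set a := fun p => √(coeffE x p) with ha
  set b := fun p => √(coeffG x p) with hb
  have hlamd := fun p hp => hlam.differentiableAt_of_isOpen hU (p := p) hp
  have hE : EqOn (coeffE x) (fun p => a p * a p) U := fun p hp =>
    (Real.mul_self_sqrt (real_inner_self_nonneg)).symm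
  have hG : EqOn (coeffG x) (fun p => b p * b p) U := fun p hp =>
    (Real.mul_self_sqrt (real_inner_self_nonneg)).symm
  have hab : ∀ p ∈ U, a p = -Real.sinh (lam p / 2) ∧ b p = Real.cosh (lam p / 2) := by
    intro p hp
    have ha0 := (hf.a_pos p hp).ne'
    have hb0 := (hf.b_pos p hp).ne'
    have had := hf.contDiffOn_a.differentiableAt_of_isOpen hU hp
    have hbd := hf.contDiffOn_b.differentiableAt_of_isOpen hU hp
    refine hf.eq_of_invariants (hlamd p hp) hp (hneg p hp) (hne p hp) h.nu1_eq h.nu2_eq ?_ ?_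
    · rw [← h.gamma1_eq p hp, gamma1, partialV_congr_of_isOpen hU hE hp, partialV_mul had had,
        hE hp]
      change _ = -(a p * partialV a p + partialV a p * a p) / (2 * (a p * a p) * b p)
      field_simp
      ring
    · rw [← h.gamma2_eq p hp, gamma2, partialU_congr_of_isOpen hU hG hp, partialU_mul hbd hbd,
        hG hp]
      change _ = (b p * partialU b p + partialU b p * b p) / (2 * (b p * b p) * a p)
      field_simp
      ring
  have hs : ∀ p ∈ U, Real.sinh (lam p / 2) ≠ 0 := fun p hp =>
    Real.sinh_ne_zero.2 (by linarith [hneg p hp])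
  have hc : ∀ p, Real.cosh (lam p / 2) ≠ 0 := fun p => (Real.cosh_pos _).ne'
  have hav : ∀ p ∈ U, partialV a p / b p = -(partialV lam p / 2) := fun p hp => by
    rw [partialV_congr_of_isOpen hU (fun q hq => (hab q hq).1) hp,
      partialV_neg_sinh_half (hlamd p hp), (hab p hp).2]
    have := hc p
    field_simp
  have hbu : ∀ p ∈ U, partialU b p / a p = -(partialU lam p / 2) := fun p hp => by
    rw [partialU_congr_of_isOpen hU (fun q hq => (hab q hq).2) hp,
      partialU_cosh_half (hlamd p hp), (hab p hp).1]
    have := hs p hp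
    field_simp
  have haν : ∀ p ∈ U, a p * nu1 x p = Real.cosh (lam p / 2) := fun p hp => by
    rw [(hab p hp).1, h.nu1_eq p hp]
    have := hs p hp
    field_simp
  have hbν : ∀ p ∈ U, b p * nu2 x p = -Real.sinh (lam p / 2) := fun p hp => by
    rw [(hab p hp).2, h.nu2_eq p hp, Real.tanh_eq_sinh_div_cosh]
    have := hc p
    field_simp
  refine ⟨X, Y, l, hf.contDiffOn_X, hf.contDiffOn_Y, hf.contDiffOn_l, hf.contDiffOn_x,
    hf.orthonormal, hf.cross_eq, fun p hp => ?_, fun p hp => ?_, fun p hp => ?_, fun p hp => ?_,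
    fun p hp => ?_, fun p hp => ?_, fun p hp => ?_, fun p hp => ?_⟩
  · rw [(hf.structure_equations hp).1, hav p hp, haν p hp, neg_neg]
  · rw [(hf.structure_equations hp).2.1, hbu p hp]
  · rw [(hf.structure_equations hp).2.2.1, hav p hp]
  · rw [(hf.structure_equations hp).2.2.2.1, hbu p hp, hbν p hp, neg_neg]
  · rw [(hf.structure_equations hp).2.2.2.2.1, haν p hp]
  · rw [(hf.structure_equations hp).2.2.2.2.2, hbν p hp, neg_neg]
  · rw [hf.xu p hp, (hab p hp).1]
  · rw [hf.xv p hp, (hab p hp).2]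

end PrincipalFrame

/-! ### Integrating the moving frame system of a sinh-Gordon solution. -/

noncomputable section Existence

variable {lam : ℝ × ℝ → ℝ}

/-- Quadruples `(X, Y, l, x)` consisting of a frame and a position vector. -/
abbrev FrameSpace : Type := E3 × E3 × E3 × E3

/-- The infinitesimal rotation `(X, Y) ↦ (Y, -X)` of the frame. -/
def rotXY : FrameSpace →L[ℝ] FrameSpace :=
  LinearMap.toContinuousLinearMap
    { toFun := fun w => (w.2.1, -w.1, 0, 0)
      map_add' := fun w z => by simp [add_comm]
      map_smul' := fun c w => by simp }

/-- The infinitesimal rotation `(X, l) ↦ (l, -X)` of the frame. -/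
def rotXl : FrameSpace →L[ℝ] FrameSpace :=
  LinearMap.toContinuousLinearMap
    { toFun := fun w => (w.2.2.1, 0, -w.1, 0)
      map_add' := fun w z => by simp [add_comm]
      map_smul' := fun c w => by simp }

/-- The infinitesimal rotation `(Y, l) ↦ (l, -Y)` of the frame. -/
def rotYl : FrameSpace →L[ℝ] FrameSpace :=
  LinearMap.toContinuousLinearMap
    { toFun := fun w => (0, w.2.2.1, -w.2.1, 0)
      map_add' := fun w z => by simp [add_comm]
      map_smul' := fun c w => by simp }

/-- The infinitesimal translation along the frame vector `X`. -/
def transX : FrameSpace →L[ℝ] FrameSpace :=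
  LinearMap.toContinuousLinearMap
    { toFun := fun w => (0, 0, 0, w.1)
      map_add' := fun w z => by simp
      map_smul' := fun c w => by simp }

/-- The infinitesimal translation along the frame vector `Y`. -/
def transY : FrameSpace →L[ℝ] FrameSpace :=
  LinearMap.toContinuousLinearMap
    { toFun := fun w => (0, 0, 0, w.2.1)
      map_add' := fun w z => by simp
      map_smul' := fun c w => by simp }

theorem rotXY_apply (w : FrameSpace) : rotXY w = (w.2.1, -w.1, 0, 0) := rfl

theorem rotXl_apply (w : FrameSpace) : rotXl w = (w.2.2.1, 0, -w.1, 0) := rfl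

theorem rotYl_apply (w : FrameSpace) : rotYl w = (0, w.2.2.1, -w.2.1, 0) := rfl

theorem transX_apply (w : FrameSpace) : transX w = (0, 0, 0, w.1) := rfl

theorem transY_apply (w : FrameSpace) : transY w = (0, 0, 0, w.2.1) := rfl

/-- The coefficient of `du` in the moving frame equations. -/
def connU (lam : ℝ × ℝ → ℝ) (p : ℝ × ℝ) : FrameSpace →L[ℝ] FrameSpace :=
  partialV lam p • (2⁻¹ : ℝ) • rotXY + Real.cosh (lam p / 2) • rotXl +
    -Real.sinh (lam p / 2) • transX

/-- The coefficient of `dv` in the moving frame equations. -/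
def connV (lam : ℝ × ℝ → ℝ) (p : ℝ × ℝ) : FrameSpace →L[ℝ] FrameSpace :=
  partialU lam p • -(2⁻¹ : ℝ) • rotXY + -Real.sinh (lam p / 2) • rotYl +
    Real.cosh (lam p / 2) • transY

theorem connU_apply (p : ℝ × ℝ) (w : FrameSpace) : connU lam p w =
    ((partialV lam p / 2) • w.2.1 + Real.cosh (lam p / 2) • w.2.2.1, -(partialV lam p / 2) • w.1,
      -Real.cosh (lam p / 2) • w.1, -Real.sinh (lam p / 2) • w.1) := by
  simp only [connU, add_apply, smul_apply, rotXY_apply,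
    rotXl_apply, transX_apply, Prod.smul_mk, Prod.mk_add_mk]
  ext1
  · module
  ext1
  · module
  ext1 <;> module

theorem connV_apply (p : ℝ × ℝ) (w : FrameSpace) : connV lam p w =
    (-(partialU lam p / 2) • w.2.1, (partialU lam p / 2) • w.1 + -Real.sinh (lam p / 2) • w.2.2.1,
      Real.sinh (lam p / 2) • w.2.1, Real.cosh (lam p / 2) • w.2.1) := by
  simp only [connV, add_apply, smul_apply, rotXY_apply,
    rotYl_apply, transY_apply, Prod.smul_mk, Prod.mk_add_mk]
  ext1
  · module
  ext1
  · module
  ext1 <;> module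

theorem contDiff_connU (h : ContDiff ℝ ∞ lam) : ContDiff ℝ ∞ (connU lam) := by
  have h1 : ContDiff ℝ ∞ (partialV lam) :=
    contDiffOn_univ.1 (h.contDiffOn.partialV isOpen_univ)
  have h2 : ContDiff ℝ ∞ (fun p => Real.cosh (lam p / 2)) := (h.div_const 2).cosh
  have h3 : ContDiff ℝ ∞ (fun p => Real.sinh (lam p / 2)) := (h.div_const 2).sinh
  exact ((h1.smul contDiff_const).add (h2.smul contDiff_const)).add (h3.neg.smul contDiff_const)

theorem contDiff_connV (h : ContDiff ℝ ∞ lam) : ContDiff ℝ ∞ (connV lam) := by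
  have h1 : ContDiff ℝ ∞ (partialU lam) :=
    contDiffOn_univ.1 (h.contDiffOn.partialU isOpen_univ)
  have h2 : ContDiff ℝ ∞ (fun p => Real.cosh (lam p / 2)) := (h.div_const 2).cosh
  have h3 : ContDiff ℝ ∞ (fun p => Real.sinh (lam p / 2)) := (h.div_const 2).sinh
  exact ((h1.smul contDiff_const).add (h3.neg.smul contDiff_const)).add (h2.smul contDiff_const)

theorem partialU_smul_const {F : Type*} [NormedAddCommGroup F] [NormedSpace ℝ F]
    {c : ℝ × ℝ → ℝ} {p : ℝ × ℝ} (hc : DifferentiableAt ℝ c p) (w : F) :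
    partialU (fun q => c q • w) p = partialU c p • w := by
  rw [partialU_smul hc (differentiableAt_const w), partialU_const, smul_zero, zero_add]

theorem partialV_smul_const {F : Type*} [NormedAddCommGroup F] [NormedSpace ℝ F]
    {c : ℝ × ℝ → ℝ} {p : ℝ × ℝ} (hc : DifferentiableAt ℝ c p) (w : F) :
    partialV (fun q => c q • w) p = partialV c p • w := by
  rw [partialV_smul hc (differentiableAt_const w), partialV_const, smul_zero, zero_add]

theorem partialV_connU (h : ContDiff ℝ ∞ lam) (p : ℝ × ℝ) : partialV (connU lam) p =
    partialV (partialV lam) p • (2⁻¹ : ℝ) • rotXY +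
      (Real.sinh (lam p / 2) * (partialV lam p / 2)) • rotXl +
      -(Real.cosh (lam p / 2) * (partialV lam p / 2)) • transX := by
  have hd := h.contDiffOn.differentiableAt_of_isOpen isOpen_univ (mem_univ p)
  have h1 := (h.contDiffOn.partialV isOpen_univ).differentiableAt_of_isOpen isOpen_univ (mem_univ p)
  have h2 := differentiableAt_cosh_half hd
  have h3 := differentiableAt_neg_sinh_half hd
  unfold connU
  rw [partialV_add ((h1.smul_const _).fun_add (h2.smul_const _)) (h3.smul_const _),
    partialV_add (h1.smul_const _) (h2.smul_const _), partialV_smul_const h1,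
    partialV_smul_const h2, partialV_smul_const h3, partialV_cosh_half hd,
    partialV_neg_sinh_half hd]

theorem partialU_connV (h : ContDiff ℝ ∞ lam) (p : ℝ × ℝ) : partialU (connV lam) p =
    partialU (partialU lam) p • -(2⁻¹ : ℝ) • rotXY +
      -(Real.cosh (lam p / 2) * (partialU lam p / 2)) • rotYl +
      (Real.sinh (lam p / 2) * (partialU lam p / 2)) • transY := by
  have hd := h.contDiffOn.differentiableAt_of_isOpen isOpen_univ (mem_univ p)
  have h1 := (h.contDiffOn.partialU isOpen_univ).differentiableAt_of_isOpen isOpen_univ (mem_univ p)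
  have h2 := differentiableAt_cosh_half hd
  have h3 := differentiableAt_neg_sinh_half hd
  unfold connV
  rw [partialU_add ((h1.smul_const _).fun_add (h3.smul_const _)) (h2.smul_const _),
    partialU_add (h1.smul_const _) (h3.smul_const _), partialU_smul_const h1,
    partialU_smul_const h2, partialU_smul_const h3, partialU_cosh_half hd,
    partialU_neg_sinh_half hd]

/-- The moving frame equations are compatible when `λ` solves the sinh-Gordon equation. -/
theorem conn_compatible (h : ContDiff ℝ ∞ lam) {p : ℝ × ℝ}
    (hsol : laplacianUV lam p = -Real.sinh (lam p)) (w : FrameSpace) :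
    partialU (connV lam) p w + connV lam p (connU lam p w) =
      partialV (connU lam) p w + connU lam p (connV lam p w) := by
  -- The sinh-Gordon equation, with `sinh λ` expanded at the half argument, is needed only for the
  -- coefficient of the rotation in the `X`, `Y` plane; the other coefficients agree for every `λ`.
  have hs : partialU (partialU lam) p = -(2 * Real.sinh (lam p / 2) * Real.cosh (lam p / 2)) -
      partialV (partialV lam) p := by
    rw [← Real.sinh_two_mul, mul_div_cancel₀ _ two_ne_zero, ← hsol, laplacianUV]; ring
  rw [partialU_connV h, partialV_connU h, hs]
  simp only [connU_apply, connV_apply, add_apply,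
    smul_apply, rotXY_apply, rotXl_apply, rotYl_apply, transX_apply,
    transY_apply, Prod.smul_mk, Prod.mk_add_mk]
  ext1
  · module
  ext1
  · module
  ext1 <;> module

/-- Frobenius, started at the standard basis and the origin, gives a solution of the linear
equations; it remains to see that the frame stays orthonormal and right-handed. Global smoothness of
`λ` provides the globally defined coefficients that the Frobenius lemma takes. -/
theorem exists_isSinhGordonFrame_of_contDiff (h : ContDiff ℝ ∞ lam) {p₀ : ℝ × ℝ}
    (hsol : ∀ᶠ p in 𝓝 p₀, laplacianUV lam p = -Real.sinh (lam p)) :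
    ∃ ε > 0, ∃ X Y l x : ℝ × ℝ → E3, IsSinhGordonFrame lam X Y l x (ball p₀ ε) := by
  have hP := contDiff_connU h
  have hQ := contDiff_connV h
  have hle : (1 : WithTop ℕ∞) ≤ ∞ := WithTop.coe_le_coe.2 (le_top : (1 : ℕ∞) ≤ ⊤)
  obtain ⟨A, hA₀, hA⟩ := exists_hasFDerivAt_of_compatible (hP.of_le hle) (hQ.of_le hle) p₀
    (EuclideanSpace.single 0 1, EuclideanSpace.single 1 1, EuclideanSpace.single 2 1, 0)
    (hsol.mono fun p hp w => conn_compatible h hp w)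
  obtain ⟨δ, hδ, hAδ⟩ := Metric.eventually_nhds_iff_ball.1 hA
  have hAs := contDiffOn_of_hasFDerivAt_linear hP.contDiffOn hQ.contDiffOn isOpen_ball hAδ
  have hAu : ∀ p ∈ ball p₀ δ, partialU A p = connU lam p (A p) := fun p hp => by
    rw [partialU, (hAδ p hp).fderiv]; simp
  have hAv : ∀ p ∈ ball p₀ δ, partialV A p = connV lam p (A p) := fun p hp => by
    rw [partialV, (hAδ p hp).fderiv]; simp
  let πX : FrameSpace →L[ℝ] E3 := ContinuousLinearMap.fst ℝ _ _
  let πY : FrameSpace →L[ℝ] E3 :=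
    (ContinuousLinearMap.fst ℝ _ _).comp (ContinuousLinearMap.snd ℝ E3 _)
  let πl : FrameSpace →L[ℝ] E3 := (ContinuousLinearMap.fst ℝ _ _).comp
    ((ContinuousLinearMap.snd ℝ E3 _).comp (ContinuousLinearMap.snd ℝ E3 _))
  let πx : FrameSpace →L[ℝ] E3 := (ContinuousLinearMap.snd ℝ _ _).comp
    ((ContinuousLinearMap.snd ℝ E3 _).comp (ContinuousLinearMap.snd ℝ E3 _))
  have hsm : ∀ π : FrameSpace →L[ℝ] E3, ContDiffOn ℝ ∞ (fun p => π (A p)) (ball p₀ δ) :=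
    fun π => π.contDiff.comp_contDiffOn hAs
  have hd : ∀ p ∈ ball p₀ δ, DifferentiableAt ℝ A p := fun p hp => (hAδ p hp).differentiableAt
  have hu : ∀ (π : FrameSpace →L[ℝ] E3), ∀ p ∈ ball p₀ δ,
      partialU (fun q => π (A q)) p = π (connU lam p (A p)) := fun π p hp => by
    rw [partialU_clm π (hd p hp), hAu p hp]
  have hv : ∀ (π : FrameSpace →L[ℝ] E3), ∀ p ∈ ball p₀ δ,
      partialV (fun q => π (A q)) p = π (connV lam p (A p)) := fun π p hp => by
    rw [partialV_clm π (hd p hp), hAv p hp]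
  have Xu : ∀ p ∈ ball p₀ δ, partialU (fun q => πX (A q)) p =
      (partialV lam p / 2) • πY (A p) + Real.cosh (lam p / 2) • πl (A p) := fun p hp => by
    rw [hu πX p hp, connU_apply]; rfl
  have Xv : ∀ p ∈ ball p₀ δ, partialV (fun q => πX (A q)) p =
      -(partialU lam p / 2) • πY (A p) := fun p hp => by
    rw [hv πX p hp, connV_apply]; rfl
  have Yu : ∀ p ∈ ball p₀ δ, partialU (fun q => πY (A q)) p =
      -(partialV lam p / 2) • πX (A p) := fun p hp => by
    rw [hu πY p hp, connU_apply]; rfl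
  have Yv : ∀ p ∈ ball p₀ δ, partialV (fun q => πY (A q)) p =
      (partialU lam p / 2) • πX (A p) + -Real.sinh (lam p / 2) • πl (A p) := fun p hp => by
    rw [hv πY p hp, connV_apply]; rfl
  have lu : ∀ p ∈ ball p₀ δ, partialU (fun q => πl (A q)) p =
      -Real.cosh (lam p / 2) • πX (A p) := fun p hp => by
    rw [hu πl p hp, connU_apply]; rfl
  have lv : ∀ p ∈ ball p₀ δ, partialV (fun q => πl (A q)) p =
      Real.sinh (lam p / 2) • πY (A p) := fun p hp => by
    rw [hv πl p hp, connV_apply]; rfl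
  have xu : ∀ p ∈ ball p₀ δ, partialU (fun q => πx (A q)) p =
      -Real.sinh (lam p / 2) • πX (A p) := fun p hp => by
    rw [hu πx p hp, connU_apply]; rfl
  have xv : ∀ p ∈ ball p₀ δ, partialV (fun q => πx (A q)) p =
      Real.cosh (lam p / 2) • πY (A p) := fun p hp => by
    rw [hv πx p hp, connV_apply]; rfl
  have hp₀ : p₀ ∈ ball p₀ δ := mem_ball_self hδ
  have hort : ∀ p ∈ ball p₀ δ, Orthonormal ℝ ![πX (A p), πY (A p), πl (A p)] := by
    intro p hp
    -- In Parseval form, skewness of the system makes the derivative of the sum cancel identically.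
    -- The inner products of the frame vectors would only satisfy another linear system, whose
    -- uniqueness would have to be invoked.
    refine orthonormal_three_of_inner_mul_inner fun z w => ?_
    have hi : ∀ (π : FrameSpace →L[ℝ] E3) (z : E3), ∀ p ∈ ball p₀ δ,
        DifferentiableAt ℝ (fun q => (inner ℝ (π (A q)) z : ℝ)) p := fun π z p hp =>
      (π.differentiableAt.comp p (hd p hp)).inner ℝ (differentiableAt_const z)
    have hiu : ∀ (π : FrameSpace →L[ℝ] E3) (z : E3), ∀ p ∈ ball p₀ δ,
        partialU (fun q => (inner ℝ (π (A q)) z : ℝ)) p =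
          inner ℝ (partialU (fun q => π (A q)) p) z := fun π z p hp => by
      rw [partialU_inner (x := fun q => π (A q)) (π.differentiableAt.comp p (hd p hp))
        (differentiableAt_const z), partialU_const, inner_zero_right, zero_add]
    have hiv : ∀ (π : FrameSpace →L[ℝ] E3) (z : E3), ∀ p ∈ ball p₀ δ,
        partialV (fun q => (inner ℝ (π (A q)) z : ℝ)) p =
          inner ℝ (partialV (fun q => π (A q)) p) z := fun π z p hp => by
      rw [partialV_inner (x := fun q => π (A q)) (π.differentiableAt.comp p (hd p hp))
        (differentiableAt_const z), partialV_const, inner_zero_right, zero_add]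
    have hii : ∀ (π : FrameSpace →L[ℝ] E3), ∀ p ∈ ball p₀ δ, DifferentiableAt ℝ
        (fun q => (inner ℝ (π (A q)) z * inner ℝ (π (A q)) w : ℝ)) p := fun π p hp =>
      (hi π z p hp).mul (hi π w p hp)
    have hconst := exists_eq_const_of_partials_eq_zero
      (f := fun q => (inner ℝ (πX (A q)) z * inner ℝ (πX (A q)) w +
        inner ℝ (πY (A q)) z * inner ℝ (πY (A q)) w +
        inner ℝ (πl (A q)) z * inner ℝ (πl (A q)) w : ℝ))
      isOpen_ball (convex_ball p₀ δ).isPreconnected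
      (fun p hp => ((hii πX p hp).add (hii πY p hp)).add (hii πl p hp)) (fun p hp => ?_)
      (fun p hp => ?_) hp hp₀
    · rw [hconst]
      simp [hA₀, πX, πY, πl, inner_eq_sum_three, EuclideanSpace.inner_single_left]
    · rw [partialU_add ((hii πX p hp).fun_add (hii πY p hp)) (hii πl p hp),
        partialU_add (hii πX p hp) (hii πY p hp), partialU_mul (hi πX z p hp) (hi πX w p hp),
        partialU_mul (hi πY z p hp) (hi πY w p hp), partialU_mul (hi πl z p hp) (hi πl w p hp)]
      simp only [hiu _ _ p hp, Xu p hp, Yu p hp, lu p hp, inner_add_left, real_inner_smul_left]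
      ring
    · rw [partialV_add ((hii πX p hp).fun_add (hii πY p hp)) (hii πl p hp),
        partialV_add (hii πX p hp) (hii πY p hp), partialV_mul (hi πX z p hp) (hi πX w p hp),
        partialV_mul (hi πY z p hp) (hi πY w p hp), partialV_mul (hi πl z p hp) (hi πl w p hp)]
      simp only [hiv _ _ p hp, Xv p hp, Yv p hp, lv p hp, inner_add_left, real_inner_smul_left]
      ring
  -- The triple product is `1` at `p₀` and continuous, so it is positive on a smaller ball; this
  -- settles the orientation.
  have hpos : ∀ᶠ p in 𝓝 p₀,
      0 < (inner ℝ (πl (A p)) (cross3 (πX (A p)) (πY (A p))) : ℝ) := by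
    have hcont : ContinuousAt
        (fun p => (inner ℝ (πl (A p)) (cross3 (πX (A p)) (πY (A p))) : ℝ)) p₀ :=
      (((hsm πl).inner ℝ ((hsm πX).cross3 (hsm πY))).continuousOn.continuousAt
        (isOpen_ball.mem_nhds hp₀))
    refine hcont.eventually_const_lt ?_
    simp [hA₀, πX, πY, πl, cross3_basis]
  obtain ⟨ε, hε, hεpos⟩ := Metric.eventually_nhds_iff_ball.1
    (hpos.and (isOpen_ball.mem_nhds hp₀ : ∀ᶠ p in 𝓝 p₀, p ∈ ball p₀ δ))
  have hsub : ball p₀ ε ⊆ ball p₀ δ := fun p hp => (hεpos p hp).2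
  exact ⟨ε, hε, fun p => πX (A p), fun p => πY (A p), fun p => πl (A p), fun p => πx (A p),
    (hsm πX).mono hsub, (hsm πY).mono hsub, (hsm πl).mono hsub, (hsm πx).mono hsub,
    fun p hp => hort p (hsub hp), fun p hp => (hort p (hsub hp)).cross3_eq (hεpos p hp).1,
    fun p hp => Xu p (hsub hp), fun p hp => Xv p (hsub hp), fun p hp => Yu p (hsub hp),
    fun p hp => Yv p (hsub hp), fun p hp => lu p (hsub hp), fun p hp => lv p (hsub hp),
    fun p hp => xu p (hsub hp), fun p hp => xv p (hsub hp)⟩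

end Existence

/-! ### Localisation in `λ` and assembly of existence and uniqueness. -/

theorem IsSinhGordonFrame.mono {lam : ℝ × ℝ → ℝ} {X Y l x : ℝ × ℝ → E3} {U V : Set (ℝ × ℝ)}
    (h : IsSinhGordonFrame lam X Y l x U) (hV : V ⊆ U) : IsSinhGordonFrame lam X Y l x V :=
  ⟨h.contDiffOn_X.mono hV, h.contDiffOn_Y.mono hV, h.contDiffOn_l.mono hV, h.contDiffOn_x.mono hV,
    fun p hp => h.orthonormal p (hV hp), fun p hp => h.cross_eq p (hV hp),
    fun p hp => h.Xu p (hV hp), fun p hp => h.Xv p (hV hp), fun p hp => h.Yu p (hV hp),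
    fun p hp => h.Yv p (hV hp), fun p hp => h.lu p (hV hp), fun p hp => h.lv p (hV hp),
    fun p hp => h.xu p (hV hp), fun p hp => h.xv p (hV hp)⟩

theorem IsSinhGordonFrame.congr {lam mu : ℝ × ℝ → ℝ} {X Y l x : ℝ × ℝ → E3} {U : Set (ℝ × ℝ)}
    (h : IsSinhGordonFrame mu X Y l x U) (heq : EqOn mu lam U) (hU : IsOpen U) :
    IsSinhGordonFrame lam X Y l x U := by
  have hu : ∀ p ∈ U, partialU mu p = partialU lam p := fun p hp =>
    partialU_congr_of_isOpen hU heq hp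
  have hv : ∀ p ∈ U, partialV mu p = partialV lam p := fun p hp =>
    partialV_congr_of_isOpen hU heq hp
  refine ⟨h.contDiffOn_X, h.contDiffOn_Y, h.contDiffOn_l, h.contDiffOn_x, h.orthonormal,
    h.cross_eq, ?_, ?_, ?_, ?_, ?_, ?_, ?_, ?_⟩ <;> intro p hp <;>
    simp only [← heq hp, ← hu p hp, ← hv p hp]
  exacts [h.Xu p hp, h.Xv p hp, h.Yu p hp, h.Yv p hp, h.lu p hp, h.lv p hp, h.xu p hp, h.xv p hp]

theorem corollary5p5 (D : Set (ℝ × ℝ)) (hD : IsOpen D) (lam : ℝ × ℝ → ℝ)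
    (hsmooth : ContDiffOn ℝ ∞ lam D)
    (hsol : ∀ p ∈ D, laplacianUV lam p = -Real.sinh (lam p))
    (hneg : ∀ p ∈ D, lam p < 0)
    (hne : ∀ p ∈ D, partialU lam p * partialV lam p ≠ 0) :
    (∀ p₀ ∈ D, ∃ D₀ : Set (ℝ × ℝ), IsOpen D₀ ∧ IsConnected D₀ ∧ p₀ ∈ D₀ ∧ D₀ ⊆ D ∧
      ∃ x : ℝ × ℝ → E3, IsSurfaceGeneratedBy lam x D₀) ∧
    (∀ U : Set (ℝ × ℝ), IsOpen U → IsConnected U → U ⊆ D →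
      ∀ x y : ℝ × ℝ → E3, IsSurfaceGeneratedBy lam x U → IsSurfaceGeneratedBy lam y U →
        ∃ φ : E3 → E3, IsMotion φ ∧ Set.EqOn y (φ ∘ x) U) := by
  refine ⟨fun p₀ hp₀ => ?_, fun U hU hUc hUD x y hx hy => ?_⟩
  -- Here `mu` is a globally smooth function with the germ of `λ` at `p₀`. The equation and the
  -- frame system involve only germs, so they pass between `mu` and `λ` on a small ball.
  · obtain ⟨mu, hmu, heq⟩ := exists_contDiff_eventuallyEq hsmooth hD hp₀
    obtain ⟨δ, hδ, hball⟩ := Metric.eventually_nhds_iff_ball.1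
      (heq.and (hD.mem_nhds hp₀ : ∀ᶠ p in 𝓝 p₀, p ∈ D))
    have hmuU : EqOn (partialU mu) (partialU lam) (ball p₀ δ) := fun p hp =>
      partialU_congr_of_isOpen isOpen_ball (fun q hq => (hball q hq).1) hp
    have hmuV : EqOn (partialV mu) (partialV lam) (ball p₀ δ) := fun p hp =>
      partialV_congr_of_isOpen isOpen_ball (fun q hq => (hball q hq).1) hp
    have hsol' : ∀ p ∈ ball p₀ δ, laplacianUV mu p = -Real.sinh (mu p) := fun p hp => by
      rw [(hball p hp).1, ← hsol p (hball p hp).2, laplacianUV, laplacianUV,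
        partialU_congr_of_isOpen isOpen_ball hmuU hp, partialV_congr_of_isOpen isOpen_ball hmuV hp]
    obtain ⟨ε, hε, X, Y, l, x, hF⟩ := exists_isSinhGordonFrame_of_contDiff hmu
      (Filter.eventually_of_mem (ball_mem_nhds p₀ hδ) hsol')
    have h1 : ball p₀ (min ε δ) ⊆ ball p₀ ε := ball_subset_ball (min_le_left _ _)
    have h2 : ball p₀ (min ε δ) ⊆ ball p₀ δ := ball_subset_ball (min_le_right _ _)
    have h3 : ball p₀ (min ε δ) ⊆ D := fun p hp => (hball p (h2 hp)).2
    have hpos : 0 < min ε δ := lt_min hε hδ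
    exact ⟨ball p₀ (min ε δ), isOpen_ball,
      (convex_ball _ _).isConnected ⟨p₀, mem_ball_self hpos⟩, mem_ball_self hpos, h3, x,
      ((hF.mono h1).congr (fun p hp => (hball p (h2 hp)).1) isOpen_ball).isSurfaceGeneratedBy
        isOpen_ball (hsmooth.mono h3) (fun p hp => hneg p (h3 hp)) fun p hp => hne p (h3 hp)⟩
  · obtain ⟨X, Y, l, hF⟩ := hx.exists_isSinhGordonFrame (hsmooth.mono hUD)
      (fun p hp => hneg p (hUD hp)) fun p hp => hne p (hUD hp)
    obtain ⟨X', Y', l', hF'⟩ := hy.exists_isSinhGordonFrame (hsmooth.mono hUD)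
      (fun p hp => hneg p (hUD hp)) fun p hp => hne p (hUD hp)
    exact hF.exists_isMotion hF' hU hUc
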